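/- Let $q\in\mathbb{C}\setminus\{0\}$ with $q^m\neq 1$ for all integers $m\ge 1$, let $N\ge 3$, $N=2n+\epsilon$ with $\epsilon\in\{0,1\}$, let $c^2\in\mathbb{R}\setminus\{0\}$, write $[2]=q+q^{-1}$, let $q'$ be a square root of $[2]$, and put $j'=N+1-j$. **The algebra $Cl_q(N)$.** Let $\rho_i=N/2-i$ if $i<i'$, $\rho_i=-(N/2-i')$ if $i>i'$, $\rho_i=0$ if $i=i'$; $C^{ij}=C_{ij}=q^{-2\rho_i}\delta_{ij'}$, $K^{ij}_{kl}=C^{ij}C_{kl}$, $\hat R^{ij}_{kl}=q^{2\delta_{ij}-2\delta_{ij'}}\delta_{il}\delta_{jk}+(q^2-q^{-2})\delta_{i<l}(\delta_{ik}\delta_{jl}-K^{ij}_{kl})$ (where $\delta_{i<l}$ is $1$ if $i<l$ and $0$ otherwise), and $P_+=\frac{1}{q^2+q^{-2}}\bigl(q^{-2}\,\mathrm{id}+\hat R-\frac{q^2-q^{-2}}{q^{2N}-1}K\bigr)$. Then $Cl_q(N)$ is the unital complex algebra generated by $\gamma_1,\dots,\gamma_N$ with relations $\sum_{k,l}(P_+)^{kl}_{ij}\gamma_k\gamma_l=0$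 for $1\le i,j\le N$ and $\sum_{i,j}C^{ij}\gamma_i\gamma_j=c^2\frac{q^{2N}-1}{q^2-1}$. **The algebra $U_q(\mathfrak{so}_N)$.** Let $d_i=2$ for $i<n$, $d_n=2-\epsilon$, $q_i=q^{d_i}$, and let $(a_{ij})_{1\le i,j\le n}$ be the Cartan matrix of $\mathfrak{so}_N$: of type $B_n$ with $\alpha_n$ the short root if $\epsilon=1$ (so $a_{n,n-1}=-2$, $a_{n-1,n}=-1$), of type $D_n$ if $\epsilon=0$ (nodes $1,\dots,n-1$ form a chain and $n$ is joined to $n-2$; for $n=2$ the matrix is $2\,\mathrm{id}$). $U_q(\mathfrak{so}_N)$ is the unital complex algebra generated by $E_i,F_i,K_i,K_i^{-1}$ ($1\le i\le n$) with relations $K_iK_j=K_jK_i$, $K_iK_i^{-1}=K_i^{-1}K_i=1$, $K_iE_jK_i^{-1}=q_i^{a_{ij}}E_j$, $K_iF_jK_i^{-1}=q_i^{-a_{ij}}F_j$, $E_iF_j-F_jE_i=\delta_{ij}\frac{K_i-K_i^{-1}}{q_i-q_i^{-1}}$, and, for $i\ne j$ and with $m=1-a_{ij}$, $\sum_{r=0}^{m}(-1)^r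 q_i^{r(m-r)}\binom{m}{r}_{q_i}X_i^{m-r}X_jX_i^r=0$ for $X=E$ and $X=F$. Here $\binom{m}{r}_p=\frac{\{m\}_p!}{\{r\}_p!\,\{m-r\}_p!}$ with $\{m\}_p!=\prod_{k=1}^m\{k\}_p$ and $\{k\}_p=\frac{1-p^{-2k}}{1-p^{-2}}$. **Notation for the formulas.** Put $\lambda_{i,j}=q^{-2\delta_{j,i}+2\delta_{j,i+1}-2\delta_{j,i'-1}+2\delta_{j,i'}}$ for $i<n$; $\lambda_{n,j}=q^{-2\delta_{j,n}+2\delta_{j,n+2}}$ if $\epsilon=1$; $\lambda_{n,j}=q^{-2\delta_{j,n-1}-2\delta_{j,n}+2\delta_{j,n+1}+2\delta_{j,n+2}}$ if $\epsilon=0$. For $m\ge 0$, numbers $f(l,r,j)$ and $X\in Cl_q(N)$ put $$S_m(f;X)=\sum_{l=0}^{m}\ \sum_{1\le j_1<\dots<j_l\le m}\Bigl(\prod_{r=1}^{l}\frac{f(l,r,j_r)}{c^2[2]\,q^{N+1-2j_r}}\Bigr)\gamma_{j_1}\cdots\gamma_{j_l}\,X\,\gamma_{j_l'}\cdots\gamma_{j_1'}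 ,$$ and let $f_i(l,r,j)=\lambda_{i,j}-q^{4l-4r}$, $\bar f_i(l,r,j)=\lambda_{i,j}^{-1}-q^{4l-4r}$, $g(l,r,j)=1-q^{4r}$. **Theorem.** There exists a homomorphism of unital complex algebras $\pi:U_q(\mathfrak{so}_N)\to Cl_q(N)$ such that, for $i=1,\dots,n-1$, $$\pi(K_i)=S_{i+1}(f_i;1),\qquad \pi(K_i^{-1})=S_{i+1}(\bar f_i;1),$$ $$\pi(E_iK_i^{-1})=\tfrac{q^{2i+1-N}}{c^2[2]}S_{i-1}(g;\gamma_{i+1}\gamma_{i'}),\qquad \pi(F_i)=\tfrac{q^{2i+1-N}}{c^2[2]}S_{i-1}(g;\gamma_i\gamma_{i'-1}),$$ further $$\pi(K_n)=q^{2-\epsilon}S_n(f_n;1),\qquad \pi(K_n^{-1})=q^{-2+\epsilon}S_n(\bar f_n;1),$$ and, if $N=2n+1$, $$\pi(E_nK_n^{-1})=\tfrac{q'}{c^2[2]}S_{n-1}(g;\gamma_{n+1}\gamma_{n+2}),\qquad \pi(F_n)=\tfrac{q^{-1}q'}{c^2[2]}S_{n-1}(g;\gamma_n\gamma_{n+1}),$$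 while, if $N=2n$, $$\pi(E_nK_n^{-1})=\tfrac{q^{-1}}{c^2[2]}S_{n-2}(g;\gamma_{n+1}\gamma_{n+2}),\qquad \pi(F_n)=\tfrac{q^{-1}}{c^2[2]}S_{n-2}(g;\gamma_{n-1}\gamma_n).$$ -/

import Mathlib

noncomputable section

namespace QuantumClifford

/-! All indices are `1`-based natural numbers, as in the mathematical notation: the generators of the
Clifford algebra are `γ_1, …, γ_N`, the generators of the quantized enveloping algebra are
`E_i, F_i, K_i, K_i⁻¹` with `1 ≤ i ≤ n`, where `N = 2 n + ε` with `ε ∈ {0, 1}`,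
that is `n = N / 2` and `ε = N % 2`. -/

/-- Kronecker's symbol as an integer. -/
def kd (i j : ℕ) : ℤ := if i = j then 1 else 0

/-- Kronecker's symbol as a complex number. -/
def kdC (i j : ℕ) : ℂ := if i = j then 1 else 0

/-- The index `j' = N + 1 - j`, for `1 ≤ j ≤ N`. -/
def bar (N j : ℕ) : ℕ := N + 1 - j

/-! ### The FRT--Clifford algebra -/

/-- The integer `2 ρ_i`, where `ρ_i = N/2 - i` for `i < i'`, `ρ_i = -(N/2 - i')` for `i' < i`, and
`ρ_i = 0` for `i = i'`. -/
def twoRho (N i : ℕ) : ℤ :=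
  if i < bar N i then (N : ℤ) - 2 * i
  else if bar N i < i then -((N : ℤ) - 2 * (bar N i : ℤ))
  else 0

/-- The metric `C^{ij} = C_{ij} = q^{-2 ρ_i} δ_{i j'}`. -/
def Cmat (q : ℂ) (N i j : ℕ) : ℂ := q ^ (-twoRho N i) * kdC i (bar N j)

/-- The entry `K^{ij}_{kl} = C^{ij} C_{kl}`. -/
def Kmat (q : ℂ) (N i j k l : ℕ) : ℂ := Cmat q N i j * Cmat q N k l

/-- The entry `R̂^{ij}_{kl}` of the braid matrix of the orthogonal quantum group. -/
def Rmat (q : ℂ) (N i j k l : ℕ) : ℂ :=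
  q ^ (2 * kd i j - 2 * kd i (bar N j)) * kdC i l * kdC j k
    + (q ^ (2 : ℤ) - q ^ (-2 : ℤ)) * (if i < l then 1 else 0)
        * (kdC i k * kdC j l - Kmat q N i j k l)

/-- The entry `(P_+)^{ij}_{kl}` of the matrix
`P_+ = (q² + q⁻²)⁻¹ (q⁻² id + R̂ - (q + q⁻¹)(q - q⁻¹) / (q^{2N} - 1) K)`. -/
def Pplus (q : ℂ) (N i j k l : ℕ) : ℂ :=
  1 / (q ^ (2 : ℤ) + q ^ (-2 : ℤ)) *
    (q ^ (-2 : ℤ) * (kdC i k * kdC j l) + Rmat q N i j k l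
      - (q + q⁻¹) * (q - q⁻¹) / (q ^ (2 * N) - 1) * Kmat q N i j k l)

/-- The letter `γ_j` of the free algebra, `1 ≤ j ≤ N` (and `0` for an index out of range). -/
def clLetter (N j : ℕ) : FreeAlgebra ℂ (Finset.Icc 1 N) :=
  if h : j ∈ Finset.Icc 1 N then FreeAlgebra.ι ℂ ⟨j, h⟩ else 0

/-- The defining relations `∑ (P_+)^{kl}_{ij} γ_k γ_l = 0` (for all `1 ≤ i, j ≤ N`) and
`∑ C^{ij} γ_i γ_j = c² (q^{2N} - 1) / (q² - 1)`; the parameter `c2` is `c²`. -/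
inductive ClRel (q c2 : ℂ) (N : ℕ) :
    FreeAlgebra ℂ (Finset.Icc 1 N) → FreeAlgebra ℂ (Finset.Icc 1 N) → Prop
  | proj (i j : ℕ) (hi : i ∈ Finset.Icc 1 N) (hj : j ∈ Finset.Icc 1 N) :
      ClRel q c2 N
        (∑ k ∈ Finset.Icc 1 N, ∑ l ∈ Finset.Icc 1 N,
          Pplus q N k l i j • (clLetter N k * clLetter N l)) 0
  | metric :
      ClRel q c2 N
        (∑ i ∈ Finset.Icc 1 N, ∑ j ∈ Finset.Icc 1 N,
          Cmat q N i j • (clLetter N i * clLetter N j))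
        (algebraMap ℂ _ (c2 * ((q ^ (2 * N) - 1) / (q ^ 2 - 1))))

/-- The FRT--Clifford algebra `Cl_q(N)` (with parameter `c² = c2`). -/
abbrev Cl (q c2 : ℂ) (N : ℕ) : Type := RingQuot (ClRel q c2 N)

/-- The generator `γ_j` of `Cl_q(N)`, `1 ≤ j ≤ N`. -/
def γ (q c2 : ℂ) (N j : ℕ) : Cl q c2 N := RingQuot.mkAlgHom ℂ (ClRel q c2 N) (clLetter N j)

/-! ### The algebra `U_q(so_N)` -/

/-- `d_i = 2` for `i < n` and `d_n = 2 - ε`. -/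
def dd (N i : ℕ) : ℤ := if i < N / 2 then 2 else 2 - ((N % 2 : ℕ) : ℤ)

/-- `q_i = q^{d_i}`. -/
def qi (q : ℂ) (N i : ℕ) : ℂ := q ^ dd N i

/-- The entry `a_{ij}`, `1 ≤ i, j ≤ n`, of the Cartan matrix of `so_N`: type `B_n` for
`N = 2 n + 1` (the root `α_n` is short, so `a_{n,n-1} = -2` and `a_{n-1,n} = -1`), type `D_n` for
`N = 2 n` (the nodes `1, …, n-1` form a chain and `n` is joined to `n-2`). The matrix
`(d_i a_{ij})` is symmetric. -/
def cartan (N i j : ℕ) : ℤ :=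
  if i = j then 2
  else if N % 2 = 1 then
    if i + 1 = j then -1
    else if j + 1 = i then (if i = N / 2 then -2 else -1)
    else 0
  else
    if (i + 1 = j ∧ j < N / 2) ∨ (j + 1 = i ∧ i < N / 2)
        ∨ (i + 2 = j ∧ j = N / 2) ∨ (j + 2 = i ∧ i = N / 2) then -1
    else 0

/-- The number `(1 - p^{-2m}) / (1 - p^{-2})`. -/
def qnum (p : ℂ) (m : ℕ) : ℂ := (1 - p ^ (-2 * (m : ℤ))) / (1 - p ^ (-2 : ℤ))

/-- The corresponding factorial. -/
def qfact (p : ℂ) (m : ℕ) : ℂ := ∏ k ∈ Finset.Icc 1 m, qnum p k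

/-- The corresponding binomial coefficient, for `r ≤ m`. -/
def qbinom (p : ℂ) (m r : ℕ) : ℂ := qfact p m / (qfact p r * qfact p (m - r))

/-- The generators of `U_q(so_N)`. -/
inductive UGen (N : ℕ) : Type
  | E (i : Finset.Icc 1 (N / 2)) : UGen N
  | F (i : Finset.Icc 1 (N / 2)) : UGen N
  | K (i : Finset.Icc 1 (N / 2)) : UGen N
  | Kinv (i : Finset.Icc 1 (N / 2)) : UGen N

/-- The letter `E_i` of the free algebra, `1 ≤ i ≤ n` (and `0` for an index out of range). -/
def letE (N i : ℕ) : FreeAlgebra ℂ (UGen N) :=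
  if h : i ∈ Finset.Icc 1 (N / 2) then FreeAlgebra.ι ℂ (UGen.E ⟨i, h⟩) else 0

/-- The letter `F_i`. -/
def letF (N i : ℕ) : FreeAlgebra ℂ (UGen N) :=
  if h : i ∈ Finset.Icc 1 (N / 2) then FreeAlgebra.ι ℂ (UGen.F ⟨i, h⟩) else 0

/-- The letter `K_i`. -/
def letK (N i : ℕ) : FreeAlgebra ℂ (UGen N) :=
  if h : i ∈ Finset.Icc 1 (N / 2) then FreeAlgebra.ι ℂ (UGen.K ⟨i, h⟩) else 0

/-- The letter `K_i⁻¹`. -/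
def letKinv (N i : ℕ) : FreeAlgebra ℂ (UGen N) :=
  if h : i ∈ Finset.Icc 1 (N / 2) then FreeAlgebra.ι ℂ (UGen.Kinv ⟨i, h⟩) else 0

/-- The quantum Serre expression
`∑_{r=0}^{m} (-1)^r p^{r(m-r)} (m choose r)_p x^{m-r} y x^r`; here `p^{r(m-r)} (m choose r)_p` is the
symmetric `p`-binomial coefficient, the one built from `(p^k - p^{-k}) / (p - p⁻¹)`. -/
def serre {A : Type} [Ring A] [Algebra ℂ A] (p : ℂ) (m : ℕ) (x y : A) : A :=
  ∑ r ∈ Finset.range (m + 1),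
    ((-1) ^ r * p ^ (r * (m - r)) * qbinom p m r) • (x ^ (m - r) * y * x ^ r)

/-- The defining relations of `U_q(so_N)`. -/
inductive URel (q : ℂ) (N : ℕ) : FreeAlgebra ℂ (UGen N) → FreeAlgebra ℂ (UGen N) → Prop
  | KK (i j : ℕ) (hi : i ∈ Finset.Icc 1 (N / 2)) (hj : j ∈ Finset.Icc 1 (N / 2)) :
      URel q N (letK N i * letK N j) (letK N j * letK N i)
  | KKinv (i : ℕ) (hi : i ∈ Finset.Icc 1 (N / 2)) :
      URel q N (letK N i * letKinv N i) 1
  | KinvK (i : ℕ) (hi : i ∈ Finset.Icc 1 (N / 2)) :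
      URel q N (letKinv N i * letK N i) 1
  | KE (i j : ℕ) (hi : i ∈ Finset.Icc 1 (N / 2)) (hj : j ∈ Finset.Icc 1 (N / 2)) :
      URel q N (letK N i * letE N j * letKinv N i) (qi q N i ^ cartan N i j • letE N j)
  | KF (i j : ℕ) (hi : i ∈ Finset.Icc 1 (N / 2)) (hj : j ∈ Finset.Icc 1 (N / 2)) :
      URel q N (letK N i * letF N j * letKinv N i) (qi q N i ^ (-cartan N i j) • letF N j)
  | EF (i j : ℕ) (hi : i ∈ Finset.Icc 1 (N / 2)) (hj : j ∈ Finset.Icc 1 (N / 2)) :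
      URel q N (letE N i * letF N j - letF N j * letE N i)
        ((kdC i j / (qi q N i - (qi q N i)⁻¹)) • (letK N i - letKinv N i))
  | serreE (i j : ℕ) (hi : i ∈ Finset.Icc 1 (N / 2)) (hj : j ∈ Finset.Icc 1 (N / 2))
      (hij : i ≠ j) :
      URel q N (serre (qi q N i) (1 - cartan N i j).toNat (letE N i) (letE N j)) 0
  | serreF (i j : ℕ) (hi : i ∈ Finset.Icc 1 (N / 2)) (hj : j ∈ Finset.Icc 1 (N / 2))
      (hij : i ≠ j) :
      URel q N (serre (qi q N i) (1 - cartan N i j).toNat (letF N i) (letF N j)) 0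

/-- The Drinfeld--Jimbo algebra `U_q(so_N)`. -/
abbrev Uqso (q : ℂ) (N : ℕ) : Type := RingQuot (URel q N)

/-- The generator `E_i` of `U_q(so_N)`. -/
def genE (q : ℂ) (N i : ℕ) : Uqso q N := RingQuot.mkAlgHom ℂ (URel q N) (letE N i)

/-- The generator `F_i` of `U_q(so_N)`. -/
def genF (q : ℂ) (N i : ℕ) : Uqso q N := RingQuot.mkAlgHom ℂ (URel q N) (letF N i)

/-- The generator `K_i` of `U_q(so_N)`. -/
def genK (q : ℂ) (N i : ℕ) : Uqso q N := RingQuot.mkAlgHom ℂ (URel q N) (letK N i)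

/-- The generator `K_i⁻¹` of `U_q(so_N)`. -/
def genKinv (q : ℂ) (N i : ℕ) : Uqso q N := RingQuot.mkAlgHom ℂ (URel q N) (letKinv N i)

/-! ### The formulas -/

/-- The numbers `λ_{i,j}`, `1 ≤ i ≤ n`, `1 ≤ j ≤ N`. -/
def lam (q : ℂ) (N i j : ℕ) : ℂ :=
  if i < N / 2 then
    q ^ (-2 * kd j i + 2 * kd j (i + 1) - 2 * kd j (bar N i - 1) + 2 * kd j (bar N i))
  else if N % 2 = 1 then
    q ^ (-2 * kd j (N / 2) + 2 * kd j (N / 2 + 2))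
  else
    q ^ (-2 * kd j (N / 2 - 1) - 2 * kd j (N / 2) + 2 * kd j (N / 2 + 1) + 2 * kd j (N / 2 + 2))

/-- The sum
`∑_{l=0}^{m} ∑_{1 ≤ j_1 < ⋯ < j_l ≤ m} (∏_{r=1}^{l} f(l, r, j_r) / (c² (q + q⁻¹) q^{N+1-2 j_r}))`
`γ_{j_1} ⋯ γ_{j_l} · mid · γ_{j_l'} ⋯ γ_{j_1'}`.
A sequence `j_1 < ⋯ < j_l` is given by the set `J` of its members, and is the increasingly sorted
list `J.sort` (whose entry number `r - 1`, counted from zero, is `j_r`). -/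
def orderedSum (q c2 : ℂ) (N m : ℕ) (f : ℕ → ℕ → ℕ → ℂ) (mid : Cl q c2 N) : Cl q c2 N :=
  ∑ l ∈ Finset.range (m + 1), ∑ J ∈ Finset.powersetCard l (Finset.Icc 1 m),
    (∏ r ∈ Finset.Icc 1 l,
      f l r (J.sort.getD (r - 1) 0)
        / (c2 * (q + q⁻¹) * q ^ ((N : ℤ) + 1 - 2 * (J.sort.getD (r - 1) 0 : ℤ)))) •
      ((J.sort.map (γ q c2 N)).prod * mid
        * (J.sort.reverse.map (fun j => γ q c2 N (bar N j))).prod)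

/-- The sum in the image of `K_i`, with `j_l ≤ m` and numerators `λ_{i,j_r} - q^{4l-4r}`. -/
def sumK (q c2 : ℂ) (N m i : ℕ) : Cl q c2 N :=
  orderedSum q c2 N m (fun l r j => lam q N i j - q ^ (4 * (l : ℤ) - 4 * r)) 1

/-- The sum in the image of `K_i⁻¹`, with `j_l ≤ m` and numerators `λ_{i,j_r}⁻¹ - q^{4l-4r}`. -/
def sumKinv (q c2 : ℂ) (N m i : ℕ) : Cl q c2 N :=
  orderedSum q c2 N m (fun l r j => (lam q N i j)⁻¹ - q ^ (4 * (l : ℤ) - 4 * r)) 1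

/-- The sum in the images of `E_i K_i⁻¹` and `F_i`, with `j_l ≤ m`, numerators `1 - q^{4r}` and
middle factor `γ_a γ_b`. -/
def sumEF (q c2 : ℂ) (N m a b : ℕ) : Cl q c2 N :=
  orderedSum q c2 N m (fun _ r _ => 1 - q ^ (4 * r)) (γ q c2 N a * γ q c2 N b)

end QuantumClifford

end

/-! The deformed Clifford algebra contains ordinary fermions, and the spinor construction of so_N,
applied to these fermions, carries over to the quantized enveloping algebra.

Written out, the defining relations say: γ_j γ_i = -q² γ_i γ_j for i < j ≠ i'; γ_i² = 0 for i ≠ i';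
and γ_i γ_{i'} + γ_{i'} γ_i for i < i' is a scalar times D_i = 1 + (q⁴ - 1) ∑_{k<i} γ_k γ_{k'} /
s_k, where s_k is `scale`; the same D_i governs the square of the middle generator
(`isQClifford_of_quad`). The element D_i has an explicit invertible square root: with τ_j² D_j = 1,
the element n_j = τ_j² γ_j γ_{j'} / s_j is idempotent and D_{j+1} = D_j (1 + (q⁴ - 1) n_j), so the
product of the factors 1 + (q² - 1) n_j squares to D. The inverse root τ commutes with each γ_k up
to a power of q, and these powers cancel the q² above. Hence the elements τγ, suitably scaled,
satisfy the canonical anticommutation relations (`TauSpec.succ`, `IsQClifford.isCAR_mode`).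

Give x_a the weight ε_a, with ε_{-a} = -ε_a and ε_0 = 0. Every simple root is ε_a + ε_b for two
modes; F_i is a multiple of x_a x_b, E_i of x_{-b} x_{-a}, and K_i is a product of the elements 1 +
(q⁻² - 1) x_m x_{-m}, normalised by a scalar. All relations of U_q(so_N) then reduce to fermion
algebra (`IsCAR.exists_algHom`).

The sums in the statement are evaluated by splitting off the largest index: the sum with numerators
μ_j - q^{4l-4r} is ∏ (1 + (μ_j - 1) n_j), and the one around γ_a γ_b is τ² γ_a γ_b
(`IsQClifford.osum_eq`, `IsQClifford.osum_root`). The fermion bilinears take the same form, because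
γ_j τ_{j+1} = τ_j γ_j and τ_{j+1} γ_{j'} = τ_j γ_{j'}. -/

noncomputable section

namespace QuantumClifford

/-! ### Canonical anticommutation relations and their group-like elements -/

section CAR

variable {A : Type} [Ring A] [Algebra ℂ A]

omit [Algebra ℂ A] in
lemma anti_left {a b : A} (h : a * b = -(b * a)) (z : A) : a * (b * z) = -(b * (a * z)) := by
  rw [← mul_assoc, h, neg_mul, mul_assoc]

omit [Algebra ℂ A] in
lemma commute_of_anti {a b c d : A} (hac : a * c = -(c * a)) (had : a * d = -(d * a))
    (hbc : b * c = -(c * b)) (hbd : b * d = -(d * b)) : a * b * (c * d) = c * d * (a * b) := by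
  simp only [mul_assoc, anti_left hac, anti_left hbc, hbd, mul_neg, neg_neg, anti_left had]

/-- Elements `x_a`, `-n ≤ a ≤ n`, subject to the canonical anticommutation relations. -/
structure IsCAR (n : ℕ) (x : ℤ → A) : Prop where
  anti : ∀ a b : ℤ, a.natAbs ≤ n → b.natAbs ≤ n → a + b ≠ 0 → x a * x b = -(x b * x a)
  pair : ∀ a : ℤ, a.natAbs ≤ n → a ≠ 0 → x a * x (-a) + x (-a) * x a = 1

namespace IsCAR

variable {n : ℕ} {x : ℤ → A}

omit [Algebra ℂ A] in
lemma neg (h : IsCAR n x) : IsCAR n (fun a => x (-a)) where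
  anti a b ha hb hab := h.anti _ _ (by omega) (by omega) (by omega)
  pair a ha ha0 := h.pair (-a) (by omega) (by omega)

lemma sq (h : IsCAR n x) {a : ℤ} (ha : a.natAbs ≤ n) (ha0 : a ≠ 0) : x a * x a = 0 := by
  have h1 := h.anti a a ha ha (by omega)
  have h2 : (2 : ℂ) • (x a * x a) = 0 := by
    rw [two_smul]
    nth_rewrite 1 [h1]
    simp
  simpa using h2

lemma sq_left (h : IsCAR n x) {a : ℤ} (ha : a.natAbs ≤ n) (ha0 : a ≠ 0) (z : A) :
    x a * (x a * z) = 0 := by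
  rw [← mul_assoc, h.sq ha ha0, zero_mul]

lemma mul_neg_mul (h : IsCAR n x) {a : ℤ} (ha : a.natAbs ≤ n) (ha0 : a ≠ 0) :
    x a * (x (-a) * x a) = x a := by
  have h1 := h.pair a ha ha0
  have h2 : x (-a) * x a = 1 - x a * x (-a) := by rw [← h1]; abel
  rw [h2, mul_sub, h.sq_left ha ha0, mul_one, sub_zero]

end IsCAR

/-- The value `1` at `l = m`, `-1` at `l = -m`, and `0` elsewhere; it is `0` for `m = 0`. -/
def charge (m l : ℤ) : ℤ := (if m = l then 1 else 0) - (if m = -l then 1 else 0)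

/-- The group-like element `p^{2 x_m x_{-m}}`, and the scalar `p` for `m = 0`. -/
def grp (x : ℤ → A) (p : ℂ) (m : ℤ) : A :=
  if m = 0 then p • 1 else 1 + (p ^ 2 - 1) • (x m * x (-m))

namespace IsCAR

variable {n : ℕ} {x : ℤ → A}

/-- The idempotent x_m x_{-m} fixes x_m from the left and kills it from the right, and the reverse
holds for x_{-m}; so the group-like element contributes p² on one side and 1 on the other. Every
other mode commutes with the even element x_m x_{-m}, and for m = 0 the group-like element is a
scalar. -/
lemma grp_mul (h : IsCAR n x) {p : ℂ} (hp : p ≠ 0) {m l : ℤ} (hm : m.natAbs ≤ n)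
    (hl : l.natAbs ≤ n) :
    grp x p m * x l = p ^ (2 * charge m l) • (x l * grp x p m) := by
  by_cases hm0 : m = 0
  · subst hm0
    have : charge 0 l = 0 := by unfold charge; split_ifs <;> omega
    simp [grp, this]
  simp only [grp, hm0, if_false]
  by_cases h1 : m = l
  · subst h1
    have : charge m m = 1 := by unfold charge; split_ifs <;> omega
    rw [this]
    simp only [add_mul, mul_add, one_mul, mul_one, smul_mul_assoc, mul_smul_comm, mul_assoc,
      h.mul_neg_mul hm hm0, h.sq_left hm hm0]
    rw [smul_zero, add_zero]
    have : p ^ (2 : ℤ) = p ^ 2 := zpow_natCast p 2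
    rw [this]
    module
  by_cases h2 : m = -l
  · obtain rfl : l = -m := by omega
    have : charge m (-m) = -1 := by unfold charge; split_ifs <;> omega
    rw [this]
    have h3 := h.neg.mul_neg_mul hm hm0
    simp only [neg_neg] at h3
    have h4 := h.neg.sq hm hm0
    simp only [add_mul, mul_add, one_mul, mul_one, smul_mul_assoc, mul_smul_comm, mul_assoc, h3, h4]
    have : p ^ (2 * (-1 : ℤ)) = (p ^ 2)⁻¹ := by rw [show (2 * (-1) : ℤ) = -2 by norm_num, zpow_neg]; norm_cast
    rw [this]
    have hp2 : p ^ 2 ≠ 0 := pow_ne_zero 2 hp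
    rw [mul_zero, smul_zero, add_zero, smul_add, smul_smul]
    match_scalars
    field_simp
    ring
  · have : charge m l = 0 := by unfold charge; split_ifs <;> omega
    rw [this]
    have a1 := h.anti (-m) l (by omega) hl (by omega)
    have a2 := h.anti m l hm hl (by omega)
    simp only [add_mul, mul_add, one_mul, mul_one, smul_mul_assoc, mul_smul_comm, mul_assoc, a1,
      mul_neg, anti_left a2, neg_neg, mul_zero, zpow_zero, one_smul]

lemma grp_mul_mul (h : IsCAR n x) {p : ℂ} (hp : p ≠ 0) {m c d : ℤ} (hm : m.natAbs ≤ n)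
    (hc : c.natAbs ≤ n) (hd : d.natAbs ≤ n) :
    grp x p m * (x c * x d) = p ^ (2 * (charge m c + charge m d)) • ((x c * x d) * grp x p m) := by
  rw [← mul_assoc, h.grp_mul hp hm hc, smul_mul_assoc, mul_assoc, h.grp_mul hp hm hd,
    mul_smul_comm, smul_smul, mul_add, zpow_add₀ hp, mul_assoc]

lemma commute_grp (h : IsCAR n x) {p p' : ℂ} (hp : p ≠ 0) {m c : ℤ} (hm : m.natAbs ≤ n)
    (hc : c.natAbs ≤ n) : grp x p m * grp x p' c = grp x p' c * grp x p m := by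
  by_cases hc0 : c = 0
  · simp only [grp, hc0, if_true, mul_smul_comm, smul_mul_assoc, mul_one, one_mul]
  have h1 := h.grp_mul_mul hp hm hc (show (-c).natAbs ≤ n by omega)
  have : charge m c + charge m (-c) = 0 := by unfold charge; split_ifs <;> omega
  rw [this, mul_zero, zpow_zero, one_smul] at h1
  rw [show grp x p' c = 1 + (p' ^ 2 - 1) • (x c * x (-c)) by simp [grp, hc0]]
  rw [mul_add, add_mul, mul_smul_comm, h1]
  simp

lemma idem (h : IsCAR n x) {a : ℤ} (ha : a.natAbs ≤ n) (ha0 : a ≠ 0) :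
    x a * x (-a) * (x a * x (-a)) = x a * x (-a) := by
  rw [← mul_assoc, mul_assoc (x a), h.mul_neg_mul ha ha0]

lemma grp_mul_grp_inv (h : IsCAR n x) {p : ℂ} (hp : p ≠ 0) {m : ℤ} (hm : m.natAbs ≤ n) :
    grp x p m * grp x p⁻¹ m = 1 := by
  by_cases hm0 : m = 0
  · simp [grp, hm0, smul_smul, hp]
  simp only [grp, hm0, if_false, mul_add, add_mul, one_mul, mul_one, smul_mul_smul_comm,
    h.idem hm hm0]
  match_scalars
  · rfl
  · field_simp
    ring

/-- The group-like element attached to the root with modes `a` and `b`. -/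
def _root_.QuantumClifford.grp₂ (x : ℤ → A) (p : ℂ) (a b : ℤ) : A :=
  (p ^ 2)⁻¹ • (grp x p a * grp x p b)

lemma grp₂_mul_inv (h : IsCAR n x) {p : ℂ} (hp : p ≠ 0) {a b : ℤ} (ha : a.natAbs ≤ n)
    (hb : b.natAbs ≤ n) : grp₂ x p a b * grp₂ x p⁻¹ a b = 1 := by
  have : grp x p a * grp x p b * (grp x p⁻¹ a * grp x p⁻¹ b) = 1 := by
    rw [mul_assoc, ← mul_assoc (grp x p b), ← h.commute_grp (inv_ne_zero hp) ha hb, mul_assoc,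
      h.grp_mul_grp_inv hp hb, mul_one, h.grp_mul_grp_inv hp ha]
  rw [grp₂, grp₂, smul_mul_smul_comm, this]
  have : (p ^ 2)⁻¹ * (p⁻¹ ^ 2)⁻¹ = 1 := by field_simp
  rw [this, one_smul]

lemma grp₂_inv_mul (h : IsCAR n x) {p : ℂ} (hp : p ≠ 0) {a b : ℤ} (ha : a.natAbs ≤ n)
    (hb : b.natAbs ≤ n) : grp₂ x p⁻¹ a b * grp₂ x p a b = 1 := by
  simpa using h.grp₂_mul_inv (inv_ne_zero hp) ha hb

lemma commute_grp₂ (h : IsCAR n x) {p p' : ℂ} (hp : p ≠ 0) {a b c d : ℤ} (ha : a.natAbs ≤ n)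
    (hb : b.natAbs ≤ n) (hc : c.natAbs ≤ n) (hd : d.natAbs ≤ n) :
    grp₂ x p a b * grp₂ x p' c d = grp₂ x p' c d * grp₂ x p a b := by
  have key : Commute (grp x p a * grp x p b) (grp x p' c * grp x p' d) :=
    ((show Commute _ _ from h.commute_grp hp ha hc).mul_right (h.commute_grp hp ha hd)).mul_left
      ((show Commute _ _ from h.commute_grp hp hb hc).mul_right (h.commute_grp hp hb hd))
  rw [grp₂, grp₂, smul_mul_smul_comm, key.eq, smul_mul_smul_comm, mul_comm (p ^ 2)⁻¹]

lemma grp₂_mul_mul (h : IsCAR n x) {p : ℂ} (hp : p ≠ 0) {a b c d : ℤ} (ha : a.natAbs ≤ n)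
    (hb : b.natAbs ≤ n) (hc : c.natAbs ≤ n) (hd : d.natAbs ≤ n) :
    grp₂ x p a b * (x c * x d) =
      p ^ (2 * (charge a c + charge a d + charge b c + charge b d)) •
        ((x c * x d) * grp₂ x p a b) := by
  rw [grp₂, smul_mul_assoc, mul_assoc, h.grp_mul_mul hp hb hc hd, mul_smul_comm, ← mul_assoc,
    h.grp_mul_mul hp ha hc hd, smul_mul_assoc, mul_smul_comm, smul_smul, smul_smul, smul_smul,
    mul_assoc (x c * x d), mul_assoc, ← zpow_add₀ hp, mul_comm]
  congr 3
  ring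

lemma conj_grp₂ (h : IsCAR n x) {p : ℂ} (hp : p ≠ 0) {a b c d : ℤ} (ha : a.natAbs ≤ n)
    (hb : b.natAbs ≤ n) (hc : c.natAbs ≤ n) (hd : d.natAbs ≤ n) :
    grp₂ x p a b * (x c * x d) * grp₂ x p⁻¹ a b =
      p ^ (2 * (charge a c + charge a d + charge b c + charge b d)) • (x c * x d) := by
  rw [h.grp₂_mul_mul hp ha hb hc hd, smul_mul_assoc, mul_assoc, h.grp₂_mul_inv hp ha hb, mul_one]

lemma _root_.QuantumClifford.grp_eq (x : ℤ → A) (p : ℂ) {a : ℤ} (ha0 : a ≠ 0) :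
    grp x p a = 1 + (p ^ 2 - 1) • (x a * x (-a)) := by
  simp [grp, ha0]

/-- With the commuting idempotents e = x_a x_{-a} and f = x_b x_{-b}, the two products are (1 - e)(1
- f) and e f, so the commutator is 1 - e - f. On the right the e f terms cancel, since p⁻²(p² - 1)²
is unchanged under p ↦ p⁻¹. -/
lemma commutator_of_ne_zero (h : IsCAR n x) {p : ℂ} (hp : p ≠ 0) (hp4 : p ^ 4 ≠ 1) {a b : ℤ}
    (ha : a.natAbs ≤ n) (hb : b.natAbs ≤ n) (ha0 : a ≠ 0) (hb0 : b ≠ 0) (hab : a ≠ b)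
    (hab' : a + b ≠ 0) :
    x (-b) * x (-a) * (x a * x b) - x a * x b * (x (-b) * x (-a)) =
      (1 / ((p ^ 2)⁻¹ - p ^ 2)) • (grp₂ x p a b - grp₂ x p⁻¹ a b) := by
  have e1 : x (-b) * x (-a) * (x a * x b) = (1 - x a * x (-a)) * (1 - x b * x (-b)) := by
    have h1 : 1 - x a * x (-a) = x (-a) * x a := by rw [← h.pair a ha ha0]; abel
    have h2 : 1 - x b * x (-b) = x (-b) * x b := by rw [← h.pair b hb hb0]; abel
    rw [h1, h2]
    have i1 := h.anti (-b) (-a) (by omega) (by omega) (by omega)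
    have i2 := h.anti (-b) a (by omega) (by omega) (by omega)
    simp only [mul_assoc, anti_left i1, anti_left i2, mul_neg, neg_neg]
  have e2 : x a * x b * (x (-b) * x (-a)) = x a * x (-a) * (x b * x (-b)) := by
    have i1 := h.anti (-b) (-a) (by omega) (by omega) (by omega)
    have i2 := h.anti b (-a) (by omega) (by omega) (by omega)
    simp only [mul_assoc, i1, anti_left i2, mul_neg, neg_neg]
  rw [e1, e2, grp₂, grp₂, grp_eq x _ ha0, grp_eq x _ hb0, grp_eq x _ ha0, grp_eq x _ hb0]
  simp only [mul_add, mul_sub, sub_mul, add_mul, one_mul, mul_one, smul_mul_assoc, mul_smul_comm]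
  have : 1 - p ^ 2 * p ^ 2 ≠ 0 := by
    intro h0; apply hp4; linear_combination -h0
  have hne : (p ^ 2)⁻¹ - p ^ 2 ≠ 0 := by
    intro h0
    apply this
    field_simp at h0
    linear_combination h0
  match_scalars <;> field_simp <;> ring

/-- The short root: x_0 squares to c, so both products lose x_0 and the commutator is c (1 - 2e)
with e = x_a x_{-a}. The denominator p⁻¹ - p, in place of p⁻² - p², reflects d_n = 1. -/
lemma commutator_zero (h : IsCAR n x) {p c : ℂ} (hp : p ≠ 0) (hp2 : p ^ 2 ≠ 1) {a : ℤ}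
    (ha : a.natAbs ≤ n) (ha0 : a ≠ 0) (h0 : x 0 * x 0 = c • 1) :
    x 0 * x (-a) * (x a * x 0) - x a * x 0 * (x 0 * x (-a)) =
      (c / (p⁻¹ - p)) • (grp₂ x p a 0 - grp₂ x p⁻¹ a 0) := by
  have h1 : x (-a) * x a = 1 - x a * x (-a) := by rw [← h.pair a ha ha0]; abel
  have i1 := h.anti 0 (-a) (by omega) (by omega) (by omega)
  have i2 := h.anti 0 a (by omega) (by omega) (by omega)
  have e1 : x 0 * x (-a) * (x a * x 0) = c • (1 - x a * x (-a)) := by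
    rw [← h1]
    simp only [mul_assoc, anti_left i1, anti_left i2, h0, mul_neg, neg_neg, mul_smul_comm, mul_one]
  have e2 : x a * x 0 * (x 0 * x (-a)) = c • (x a * x (-a)) := by
    rw [mul_assoc, ← mul_assoc (x 0), h0]
    simp
  rw [e1, e2, grp₂, grp₂, grp_eq x _ ha0, grp_eq x _ ha0]
  simp only [grp, if_true, mul_one, mul_smul_comm]
  have : 1 - p * p ≠ 0 := by
    intro h0; apply hp2; linear_combination -h0
  have hne : p⁻¹ - p ≠ 0 := by
    intro h0
    apply this
    field_simp at h0
    linear_combination h0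
  match_scalars <;> (field_simp; try ring)

/-- The right multiplication of a raising operator by the group-like element of its root. -/
lemma mul_grp₂ (h : IsCAR n x) {p : ℂ} {a b : ℤ} (ha : a.natAbs ≤ n)
    (hb : b.natAbs ≤ n) (ha0 : a ≠ 0) (hb0 : b ≠ 0) (hab' : a + b ≠ 0) (hab : a ≠ b) (hp : p ≠ 0) :
    x (-b) * x (-a) * grp₂ x p a b = p ^ 2 • (x (-b) * x (-a)) := by
  have ea : x (-a) * grp x p a = p ^ 2 • x (-a) := by
    have h3 := h.neg.mul_neg_mul ha ha0
    simp only [neg_neg] at h3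
    rw [grp_eq x p ha0, mul_add, mul_smul_comm, h3, mul_one]
    module
  have eb : x (-b) * grp x p b = p ^ 2 • x (-b) := by
    have h3 := h.neg.mul_neg_mul hb hb0
    simp only [neg_neg] at h3
    rw [grp_eq x p hb0, mul_add, mul_smul_comm, h3, mul_one]
    module
  have hc : grp x p b * x (-a) = x (-a) * grp x p b := by
    have := h.grp_mul hp hb (show (-a).natAbs ≤ n by omega)
    rwa [show charge b (-a) = 0 by unfold charge; split_ifs <;> omega, mul_zero, zpow_zero,
      one_smul] at this
  rw [grp₂, mul_smul_comm, mul_assoc, ← mul_assoc (x (-a)), ea, smul_mul_assoc, ← hc,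
    mul_smul_comm, ← mul_assoc, eb, smul_mul_assoc, smul_smul, inv_mul_cancel₀ (pow_ne_zero 2 hp),
    one_smul]

lemma mul_grp₂_zero (h : IsCAR n x) {p : ℂ} {a : ℤ} (ha : a.natAbs ≤ n)
    (ha0 : a ≠ 0) (hp : p ≠ 0) :
    x 0 * x (-a) * grp₂ x p a 0 = p • (x 0 * x (-a)) := by
  have ea : x (-a) * grp x p a = p ^ 2 • x (-a) := by
    have h3 := h.neg.mul_neg_mul ha ha0
    simp only [neg_neg] at h3
    rw [grp_eq x p ha0, mul_add, mul_smul_comm, h3, mul_one]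
    module
  rw [grp₂, mul_smul_comm, mul_assoc, ← mul_assoc (x (-a)), ea]
  simp only [grp, if_true, mul_smul_comm, smul_smul, mul_one]
  congr 1
  field_simp

/-- A sufficient condition for the quantum Serre relations of order `m`. -/
def _root_.QuantumClifford.SerreZero (m : ℕ) (u v : A) : Prop :=
  (m = 1 ∧ u * v = v * u) ∨ (m = 2 ∧ u * u = 0 ∧ u * v * u = 0) ∨ (m = 3 ∧ u * u = 0)

lemma _root_.QuantumClifford.SerreZero.smul {m : ℕ} {u v : A} (h : SerreZero m u v) (s t : ℂ) :
    SerreZero m (s • u) (t • v) := by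
  rcases h with ⟨hm, h⟩ | ⟨hm, h, h'⟩ | ⟨hm, h⟩
  · exact Or.inl ⟨hm, by simp only [smul_mul_smul_comm, h, mul_comm s t]⟩
  · exact Or.inr (Or.inl ⟨hm, by simp only [smul_mul_smul_comm, h, smul_zero],
      by simp only [smul_mul_smul_comm, h', smul_zero]⟩)
  · exact Or.inr (Or.inr ⟨hm, by simp only [smul_mul_smul_comm, h, smul_zero]⟩)

/-- For m = 3 every term contains u², and for m = 2 every term contains u² or is a multiple of u v
u, so the coefficients are irrelevant. Only m = 1 needs them: p² ≠ 1 keeps the q-number in the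
denominator from vanishing. -/
lemma _root_.QuantumClifford.SerreZero.serre_eq_zero {m : ℕ} {u v : A} (h : SerreZero m u v) {p : ℂ}
    (hp : p ≠ 0) (hp2 : p ^ 2 ≠ 1) :
    serre p m u v = 0 := by
  rcases h with ⟨rfl, h⟩ | ⟨rfl, h, h'⟩ | ⟨rfl, h⟩
  · have h1 : 1 - (p ^ 2)⁻¹ ≠ 0 := by
      intro h0
      apply hp2
      field_simp at h0
      linear_combination h0
    have hz : p ^ (-2 : ℤ) = (p ^ 2)⁻¹ := by rw [zpow_neg]; norm_cast
    simp [serre, Finset.sum_range_succ, qbinom, qfact, qnum, h, hz, h1]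
  · rw [mul_assoc] at h'
    simp [serre, Finset.sum_range_succ, pow_two, h, h', mul_assoc]
  · have h3 : u ^ 3 = 0 := by rw [pow_succ, pow_two, h, zero_mul]
    simp [serre, Finset.sum_range_succ, pow_two, h, h3, mul_assoc]

end IsCAR

end CAR

/-! ### Simple roots as pairs of modes, and the Cartan matrix -/

section Roots

/-- The first mode of the simple root vector `F_i`. -/
def modeA (N i : ℕ) : ℤ := if i < N / 2 ∨ N % 2 = 1 then i else i - 1

/-- The second mode of the simple root vector `F_i`. -/
def modeB (N i : ℕ) : ℤ := if i < N / 2 then -(i + 1) else if N % 2 = 1 then 0 else i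

lemma mode_cases {N i : ℕ} (hN : 3 ≤ N) (hi : i ∈ Finset.Icc 1 (N / 2)) :
    (i < N / 2 ∧ modeA N i = i ∧ modeB N i = -(i + 1)) ∨
    (i = N / 2 ∧ N % 2 = 1 ∧ modeA N i = i ∧ modeB N i = 0) ∨
    (i = N / 2 ∧ N % 2 = 0 ∧ 2 ≤ i ∧ modeA N i = i - 1 ∧ modeB N i = i) := by
  rw [Finset.mem_Icc] at hi
  unfold modeA modeB
  split_ifs <;> omega

lemma mode_props {N i : ℕ} (hN : 3 ≤ N) (hi : i ∈ Finset.Icc 1 (N / 2)) :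
    (modeA N i).natAbs ≤ N / 2 ∧ (modeB N i).natAbs ≤ N / 2 ∧ modeA N i ≠ 0 ∧
      modeA N i ≠ modeB N i ∧ modeA N i + modeB N i ≠ 0 := by
  have := mode_cases hN hi
  rw [Finset.mem_Icc] at hi
  omega

lemma dd_spec (N i : ℕ) : ((i < N / 2 ∨ N % 2 = 0) ∧ dd N i = 2) ∨
    ((N / 2 ≤ i ∧ N % 2 = 1) ∧ dd N i = 1) := by
  unfold dd
  split_ifs <;> omega

lemma cartan_spec (N i j : ℕ) :
    (i = j ∧ i = j ∧ cartan N i j = 2) ∨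
    (N % 2 = 1 ∧ (i + 1 = j ∨ (j + 1 = i ∧ i ≠ N / 2)) ∧ cartan N i j = -1) ∨
    (N % 2 = 1 ∧ (j + 1 = i ∧ i = N / 2) ∧ cartan N i j = -2) ∨
    (N % 2 = 1 ∧ (i ≠ j ∧ i + 1 ≠ j ∧ j + 1 ≠ i) ∧ cartan N i j = 0) ∨
    (N % 2 = 0 ∧ (i ≠ j ∧ ((i + 1 = j ∧ j < N / 2) ∨ (j + 1 = i ∧ i < N / 2) ∨
      (i + 2 = j ∧ j = N / 2) ∨ (j + 2 = i ∧ i = N / 2))) ∧ cartan N i j = -1) ∨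
    (N % 2 = 0 ∧ (i ≠ j ∧ ¬ ((i + 1 = j ∧ j < N / 2) ∨ (j + 1 = i ∧ i < N / 2) ∨
      (i + 2 = j ∧ j = N / 2) ∨ (j + 2 = i ∧ i = N / 2))) ∧ cartan N i j = 0) := by
  by_cases hij : i = j
  · exact Or.inl ⟨hij, hij, if_pos hij⟩
  rw [cartan, if_neg hij]
  by_cases hN : N % 2 = 1
  · rw [if_pos hN]
    by_cases h1 : i + 1 = j
    · exact Or.inr (Or.inl ⟨hN, Or.inl h1, if_pos h1⟩)
    rw [if_neg h1]
    by_cases h2 : j + 1 = i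
    · rw [if_pos h2]
      by_cases h3 : i = N / 2
      · exact Or.inr (Or.inr (Or.inl ⟨hN, ⟨h2, h3⟩, if_pos h3⟩))
      · exact Or.inr (Or.inl ⟨hN, Or.inr ⟨h2, h3⟩, if_neg h3⟩)
    · exact Or.inr (Or.inr (Or.inr (Or.inl ⟨hN, ⟨hij, h1, h2⟩, if_neg h2⟩)))
  · have hN' : N % 2 = 0 := by omega
    rw [if_neg hN]
    by_cases h : (i + 1 = j ∧ j < N / 2) ∨ (j + 1 = i ∧ i < N / 2) ∨
        (i + 2 = j ∧ j = N / 2) ∨ (j + 2 = i ∧ i = N / 2)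
    · exact Or.inr (Or.inr (Or.inr (Or.inr (Or.inl ⟨hN', ⟨hij, h⟩, if_pos h⟩))))
    · exact Or.inr (Or.inr (Or.inr (Or.inr (Or.inr ⟨hN', ⟨hij, h⟩, if_neg h⟩))))

/-- The sum of charges is the inner product of ε_a + ε_b with ε_c + ε_d for orthonormal ε, so this
is the usual symmetrisation d_i a_{ij} = 2 (α_i, α_j). -/
lemma dd_mul_cartan {N i j : ℕ} (hN : 3 ≤ N) (hi : i ∈ Finset.Icc 1 (N / 2))
    (hj : j ∈ Finset.Icc 1 (N / 2)) :
    dd N i * cartan N i j =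
      2 * (charge (modeA N i) (modeA N j) + charge (modeA N i) (modeB N j) +
        charge (modeB N i) (modeA N j) + charge (modeB N i) (modeB N j)) := by
  have h1 := mode_cases hN hi
  have h2 := mode_cases hN hj
  rw [Finset.mem_Icc] at hi hj
  generalize modeA N i = a at *
  generalize modeB N i = b at *
  generalize modeA N j = c at *
  generalize modeB N j = d at *
  rcases dd_spec N i with ⟨e1, e2⟩ | ⟨e1, e2⟩ <;> rw [e2] <;>
  rcases cartan_spec N i j with h | h | h | h | h | h <;> rw [h.2.2] <;>
  rcases h1 with ⟨h1, rfl, rfl⟩ | ⟨h1, h1', rfl, rfl⟩ | ⟨h1, h1', h1'', rfl, rfl⟩ <;>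
  rcases h2 with ⟨h2, rfl, rfl⟩ | ⟨h2, h2', rfl, rfl⟩ | ⟨h2, h2', h2'', rfl, rfl⟩ <;>
  first
  | (exfalso; omega)
  | (simp only [charge]
     simp (disch := omega) only [if_pos, if_neg]
     try split_ifs
     all_goals omega)

end Roots

/-! ### Serre relations and commutation of E_i with F_j for fermion bilinears -/

section SerreRelations

variable {A : Type} [Ring A] [Algebra ℂ A] {x : ℤ → A}

omit [Algebra ℂ A] in
lemma mul_self_of_anti {a b : A} (hab : a * b = -(b * a)) (ha : a * a = 0) :
    a * b * (a * b) = 0 := by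
  have hba : b * a = -(a * b) := by rw [hab, neg_neg]
  rw [mul_assoc, anti_left hba, mul_neg, ← mul_assoc, ← mul_assoc, ha]
  simp

namespace IsCAR

variable {n : ℕ}

lemma mul_self_eq_zero (h : IsCAR n x) {a b : ℤ} (ha : a.natAbs ≤ n) (hb : b.natAbs ≤ n)
    (hab : a + b ≠ 0) (ha0 : a ≠ 0) : x a * x b * (x a * x b) = 0 :=
  mul_self_of_anti (h.anti a b ha hb hab) (h.sq ha ha0)

omit [Algebra ℂ A] in
lemma commute_bilinear (h : IsCAR n x) {a b c d : ℤ} (ha : a.natAbs ≤ n) (hb : b.natAbs ≤ n)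
    (hc : c.natAbs ≤ n) (hd : d.natAbs ≤ n) (hac : a + c ≠ 0) (had : a + d ≠ 0)
    (hbc : b + c ≠ 0) (hbd : b + d ≠ 0) : x a * x b * (x c * x d) = x c * x d * (x a * x b) :=
  commute_of_anti (h.anti a c ha hc hac) (h.anti a d ha hd had) (h.anti b c hb hc hbc)
    (h.anti b d hb hd hbd)

/-- Two bilinears sharing their second mode multiply to zero. -/
lemma bilinear_mul_of_shared (h : IsCAR n x) {a b c : ℤ} (hb : b.natAbs ≤ n)
    (hc : c.natAbs ≤ n) (hb0 : b ≠ 0) (hbc : b + c ≠ 0) :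
    x a * x b * (x c * x b) = 0 := by
  rw [h.anti c b hc hb (by omega), mul_neg, mul_assoc, h.sq_left hb hb0]
  simp

/-- A bilinear sandwiches to zero everything that commutes with one of its modes. -/
lemma sandwich_left (h : IsCAR n x) {a b c d : ℤ} (ha : a.natAbs ≤ n) (hb : b.natAbs ≤ n)
    (hc : c.natAbs ≤ n) (hd : d.natAbs ≤ n) (ha0 : a ≠ 0) (hab : a + b ≠ 0) (hac : a + c ≠ 0)
    (had : a + d ≠ 0) : x a * x b * (x c * x d) * (x a * x b) = 0 := by
  have h1 := h.anti b a hb ha (by omega)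
  have h2 := h.anti c a hc ha (by omega)
  have h3 := h.anti d a hd ha (by omega)
  simp only [mul_assoc, anti_left h3, anti_left h2, anti_left h1, mul_neg, neg_neg,
    h.sq_left ha ha0, neg_zero]

lemma sandwich_right (h : IsCAR n x) {a b c d : ℤ} (ha : a.natAbs ≤ n) (hb : b.natAbs ≤ n)
    (hc : c.natAbs ≤ n) (hd : d.natAbs ≤ n) (hb0 : b ≠ 0) (hab : a + b ≠ 0) (hbc : b + c ≠ 0)
    (hbd : b + d ≠ 0) : x a * x b * (x c * x d) * (x a * x b) = 0 := by
  have h1 := h.anti b a hb ha (by omega)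
  have := h.sandwich_left hb ha hc hd hb0 (by omega) hbc hbd
  rw [h1] at this
  simpa using this

/-- Each root vector squares to zero, which settles a_{ij} = -2. For a_{ij} = -1, one mode of the
first root vector is opposite to no mode of the second; it anticommutes past everything between its
two occurrences in u v u and squares to zero. -/
lemma serreZero_F {N : ℕ} (hN : 3 ≤ N) (h : IsCAR (N / 2) x) {i j : ℕ}
    (hi : i ∈ Finset.Icc 1 (N / 2)) (hj : j ∈ Finset.Icc 1 (N / 2)) (hij : i ≠ j) :
    SerreZero (1 - cartan N i j).toNat (x (modeA N i) * x (modeB N i))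
      (x (modeA N j) * x (modeB N j)) := by
  have h1 := mode_cases hN hi
  have h2 := mode_cases hN hj
  obtain ⟨p1, p2, p3, p4, p5⟩ := mode_props hN hi
  obtain ⟨r1, r2, r3, r4, r5⟩ := mode_props hN hj
  rw [Finset.mem_Icc] at hi hj
  generalize modeA N i = a at *
  generalize modeB N i = b at *
  generalize modeA N j = c at *
  generalize modeB N j = d at *
  have hsq := h.mul_self_eq_zero p1 p2 p5 p3
  have hspec := cartan_spec N i j
  have hcart : cartan N i j = 0 ∨ cartan N i j = -1 ∨ (cartan N i j = -2 ∧ b = 0) := by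
    omega
  rcases hcart with hc | hc | ⟨hc, -⟩
  · refine Or.inl ⟨by rw [hc]; rfl, ?_⟩
    by_cases hbd : a + d = 0 ∨ a + c = 0 ∨ b + c = 0 ∨ b + d = 0
    -- Orthogonal roots with opposite modes occur only for the two end nodes of type D, where both
    -- root vectors contain x_{n-1} and so both products vanish.
    · obtain rfl : a = c := by omega
      rw [h.anti a b p1 p2 p5, h.anti a d p1 r2 r5]
      simp only [neg_mul_neg]
      rw [h.bilinear_mul_of_shared p1 r2 p3 (by omega), h.bilinear_mul_of_shared p1 p2 p3 (by omega)]
    · exact h.commute_bilinear p1 p2 r1 r2 (by omega) (by omega) (by omega) (by omega)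
  · refine Or.inr (Or.inl ⟨by rw [hc]; rfl, hsq, ?_⟩)
    by_cases ha : a + c ≠ 0 ∧ a + d ≠ 0
    · exact h.sandwich_left p1 p2 r1 r2 p3 p5 ha.1 ha.2
    · exact h.sandwich_right p1 p2 r1 r2 (by omega) p5 (by omega) (by omega)
  · exact Or.inr (Or.inr ⟨by rw [hc]; rfl, hsq⟩)

/-- The modes a ↦ x_{-a} satisfy the same relations and turn each F into E up to the sign from
reordering the two factors. -/
lemma serreZero_E {N : ℕ} (hN : 3 ≤ N) (h : IsCAR (N / 2) x) {i j : ℕ}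
    (hi : i ∈ Finset.Icc 1 (N / 2)) (hj : j ∈ Finset.Icc 1 (N / 2)) (hij : i ≠ j) :
    SerreZero (1 - cartan N i j).toNat (x (-modeB N i) * x (-modeA N i))
      (x (-modeB N j) * x (-modeA N j)) := by
  obtain ⟨p1, p2, p3, p4, p5⟩ := mode_props hN hi
  obtain ⟨r1, r2, r3, r4, r5⟩ := mode_props hN hj
  have := (h.neg.serreZero_F hN hi hj hij).smul (-1) (-1)
  rw [h.anti _ _ (by omega) (by omega) (by omega), h.anti (-modeB N j) _ (by omega) (by omega)
    (by omega)]
  simpa using this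

/-- Opposite modes would obstruct commutation. For i ≠ j they occur only between the two end nodes
of type D, and there the bilinears also share a mode, so both products are zero. -/
lemma commute_E_F {N : ℕ} (hN : 3 ≤ N) (h : IsCAR (N / 2) x) {i j : ℕ}
    (hi : i ∈ Finset.Icc 1 (N / 2)) (hj : j ∈ Finset.Icc 1 (N / 2)) (hij : i ≠ j) :
    x (-modeB N i) * x (-modeA N i) * (x (modeA N j) * x (modeB N j)) =
      x (modeA N j) * x (modeB N j) * (x (-modeB N i) * x (-modeA N i)) := by
  have h1 := mode_cases hN hi
  have h2 := mode_cases hN hj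
  obtain ⟨p1, p2, p3, p4, p5⟩ := mode_props hN hi
  obtain ⟨r1, r2, r3, r4, r5⟩ := mode_props hN hj
  rw [Finset.mem_Icc] at hi hj
  generalize modeA N i = a at *
  generalize modeB N i = b at *
  generalize modeA N j = c at *
  generalize modeB N j = d at *
  by_cases hs : -b = d
  · subst hs
    rw [h.anti (-b) (-a) (by omega) (by omega) (by omega), neg_mul,
      h.bilinear_mul_of_shared r2 r1 (by omega) (by omega), mul_neg,
      h.bilinear_mul_of_shared r2 (by omega) (by omega) (by omega)]
  by_cases hs' : -a = d
  · subst hs'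
    rw [h.bilinear_mul_of_shared r2 r1 (by omega) (by omega),
      h.bilinear_mul_of_shared r2 (by omega) (by omega) (by omega)]
  · apply h.commute_bilinear <;> omega

end IsCAR

end SerreRelations

/-! ### The homomorphism from U_q(so_N) into an algebra with fermions -/

section Hom

variable {A : Type} [Ring A] [Algebra ℂ A] {x : ℤ → A}

/-- The images of the generators of `U_q(so_N)`, up to the normalisations `t` and `u` of the root
vectors. -/
def imageGen (q : ℂ) (N : ℕ) (x : ℤ → A) (t u : ℕ → ℂ) : UGen N → A
  | .E i => t i • (x (-modeB N i) * x (-modeA N i))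
  | .F i => u i • (x (modeA N i) * x (modeB N i))
  | .K i => grp₂ x q⁻¹ (modeA N i) (modeB N i)
  | .Kinv i => grp₂ x q (modeA N i) (modeB N i)

lemma zpow_zpow_dd_cartan {q : ℂ} {N i j : ℕ} (hN : 3 ≤ N)
    (hi : i ∈ Finset.Icc 1 (N / 2)) (hj : j ∈ Finset.Icc 1 (N / 2)) :
    qi q N i ^ cartan N i j = q ^ (2 * (charge (modeA N i) (modeA N j) +
      charge (modeA N i) (modeB N j) + charge (modeB N i) (modeA N j) +
      charge (modeB N i) (modeB N j))) := by
  rw [← dd_mul_cartan hN hi hj, qi, zpow_mul]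

lemma charge_neg (m l : ℤ) : charge m (-l) = -charge m l := by
  unfold charge
  rw [neg_neg]
  ring

variable {q : ℂ} {N : ℕ} {t u : ℕ → ℂ} {c : ℂ}

/-- The normalisations t and u enter only through the product t_i u_i in the commutator of E_i and
F_i; the factor c in `htu` is the square of x_0, present for the short root alone. All other
relations are homogeneous in t and u. -/
theorem IsCAR.exists_algHom (h : IsCAR (N / 2) x) (hq0 : q ≠ 0)
    (hq : ∀ m : ℕ, 1 ≤ m → q ^ m ≠ 1) (hN : 3 ≤ N) (hx : N % 2 = 1 → x 0 * x 0 = c • 1)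
    (htu : ∀ i ∈ Finset.Icc 1 (N / 2), t i * u i * (if modeB N i = 0 then c else 1) = 1) :
    ∃ π : Uqso q N →ₐ[ℂ] A, ∀ i ∈ Finset.Icc 1 (N / 2),
      π (genE q N i) = t i • (x (-modeB N i) * x (-modeA N i)) ∧
      π (genF q N i) = u i • (x (modeA N i) * x (modeB N i)) ∧
      π (genK q N i) = grp₂ x q⁻¹ (modeA N i) (modeB N i) ∧
      π (genKinv q N i) = grp₂ x q (modeA N i) (modeB N i) := by
  have hE : ∀ i ∈ Finset.Icc 1 (N / 2), FreeAlgebra.lift ℂ (imageGen q N x t u) (letE N i) =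
      t i • (x (-modeB N i) * x (-modeA N i)) := fun i hi => by
    simp [letE, hi, imageGen, -Finset.mem_Icc]
  have hF : ∀ i ∈ Finset.Icc 1 (N / 2), FreeAlgebra.lift ℂ (imageGen q N x t u) (letF N i) =
      u i • (x (modeA N i) * x (modeB N i)) := fun i hi => by
    simp [letF, hi, imageGen, -Finset.mem_Icc]
  have hK : ∀ i ∈ Finset.Icc 1 (N / 2), FreeAlgebra.lift ℂ (imageGen q N x t u) (letK N i) =
      grp₂ x q⁻¹ (modeA N i) (modeB N i) := fun i hi => by
    simp [letK, hi, imageGen, -Finset.mem_Icc]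
  have hKi : ∀ i ∈ Finset.Icc 1 (N / 2), FreeAlgebra.lift ℂ (imageGen q N x t u) (letKinv N i) =
      grp₂ x q (modeA N i) (modeB N i) := fun i hi => by
    simp [letKinv, hi, imageGen, -Finset.mem_Icc]
  have hqi0 : ∀ i, qi q N i ≠ 0 := fun i => zpow_ne_zero _ hq0
  have hqi2 : ∀ i, qi q N i ^ 2 ≠ 1 := fun i => by
    have h1 : dd N i = 1 ∨ dd N i = 2 := by unfold dd; split_ifs <;> omega
    rcases h1 with h1 | h1
    · rw [qi, h1, zpow_one]; exact hq 2 (by norm_num)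
    · rw [qi, h1, show q ^ (2 : ℤ) = q ^ 2 from zpow_natCast q 2, ← pow_mul]
      exact hq 4 (by norm_num)
  have serre_map : ∀ (p : ℂ) (m : ℕ) (y z : FreeAlgebra ℂ (UGen N)),
      FreeAlgebra.lift ℂ (imageGen q N x t u) (serre p m y z) =
        serre p m (FreeAlgebra.lift ℂ (imageGen q N x t u) y)
          (FreeAlgebra.lift ℂ (imageGen q N x t u) z) := fun p m y z => by
    simp [serre, map_sum]
  have hrel : ∀ ⦃y z⦄, URel q N y z → FreeAlgebra.lift ℂ (imageGen q N x t u) y =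
      FreeAlgebra.lift ℂ (imageGen q N x t u) z := by
    intro y z hyz
    induction hyz with
    | KK i j hi hj =>
      obtain ⟨p1, p2, -⟩ := mode_props hN hi
      obtain ⟨r1, r2, -⟩ := mode_props hN hj
      rw [map_mul, map_mul, hK i hi, hK j hj, h.commute_grp₂ (inv_ne_zero hq0) p1 p2 r1 r2]
    | KKinv i hi =>
      obtain ⟨p1, p2, -⟩ := mode_props hN hi
      rw [map_mul, hK i hi, hKi i hi, map_one, h.grp₂_inv_mul hq0 p1 p2]
    | KinvK i hi =>
      obtain ⟨p1, p2, -⟩ := mode_props hN hi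
      rw [map_mul, hK i hi, hKi i hi, map_one, h.grp₂_mul_inv hq0 p1 p2]
    | KE i j hi hj =>
      obtain ⟨p1, p2, -⟩ := mode_props hN hi
      obtain ⟨r1, r2, -⟩ := mode_props hN hj
      have := h.conj_grp₂ (inv_ne_zero hq0) p1 p2 (show (-modeB N j).natAbs ≤ N / 2 by omega)
        (show (-modeA N j).natAbs ≤ N / 2 by omega)
      rw [inv_inv] at this
      rw [map_mul, map_mul, map_smul, hK i hi, hKi i hi, hE j hj, mul_smul_comm, smul_mul_assoc,
        this, zpow_zpow_dd_cartan hN hi hj, smul_comm, inv_zpow']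
      simp only [charge_neg]
      congr 2
      ring
    | KF i j hi hj =>
      obtain ⟨p1, p2, -⟩ := mode_props hN hi
      obtain ⟨r1, r2, -⟩ := mode_props hN hj
      have := h.conj_grp₂ (inv_ne_zero hq0) p1 p2 r1 r2
      rw [inv_inv] at this
      rw [map_mul, map_mul, map_smul, hK i hi, hKi i hi, hF j hj, mul_smul_comm, smul_mul_assoc,
        this, zpow_neg, zpow_zpow_dd_cartan hN hi hj, smul_comm, inv_zpow', zpow_neg]
    | EF i j hi hj =>
      rw [map_sub, map_mul, map_mul, map_smul, map_sub, hE i hi, hF j hj, hK i hi, hKi i hi,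
        smul_mul_smul_comm, smul_mul_smul_comm, mul_comm (u j)]
      by_cases hij : i = j
      · subst hij
        obtain ⟨p1, p2, p3, p4, p5⟩ := mode_props hN hi
        have hm := mode_cases hN hi
        have htu' := htu i hi
        rw [← smul_sub]
        by_cases hb : modeB N i = 0
        · have hodd : N % 2 = 1 := by omega
          have hdd : dd N i = 1 := by unfold dd; split_ifs <;> omega
          rw [if_pos hb] at htu'
          rw [hb, neg_zero, h.commutator_zero (inv_ne_zero hq0)
            (by rw [inv_pow]; exact inv_ne_one.2 (hq 2 (by norm_num))) p1 p3 (hx hodd), smul_smul,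
            inv_inv, qi, hdd, zpow_one, ← mul_div_assoc, htu', kdC, if_pos rfl]
        · have hdd : dd N i = 2 := by
            unfold dd
            rw [Finset.mem_Icc] at hi
            split_ifs <;> omega
          rw [if_neg hb, mul_one] at htu'
          rw [h.commutator_of_ne_zero (inv_ne_zero hq0)
            (by rw [inv_pow]; exact inv_ne_one.2 (hq 4 (by norm_num))) p1 p2 p3 hb p4 p5, htu',
            one_smul, inv_inv, qi, hdd, show q ^ (2 : ℤ) = q ^ 2 from zpow_natCast q 2, inv_pow,
            inv_inv, kdC, if_pos rfl]
      · rw [h.commute_E_F hN hi hj hij, sub_self, kdC, if_neg hij, zero_div, zero_smul]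
    | serreE i j hi hj hij =>
      rw [serre_map, map_zero, hE i hi, hE j hj]
      exact ((h.serreZero_E hN hi hj hij).smul _ _).serre_eq_zero (hqi0 i) (hqi2 i)
    | serreF i j hi hj hij =>
      rw [serre_map, map_zero, hF i hi, hF j hj]
      exact ((h.serreZero_F hN hi hj hij).smul _ _).serre_eq_zero (hqi0 i) (hqi2 i)
  refine ⟨RingQuot.liftAlgHom ℂ ⟨FreeAlgebra.lift ℂ (imageGen q N x t u), hrel⟩, fun i hi => ?_⟩
  simp only [genE, genF, genK, genKinv, RingQuot.liftAlgHom_mkAlgHom_apply]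
  exact ⟨hE i hi, hF i hi, hK i hi, hKi i hi⟩

end Hom

/-! ### Explicit q-Clifford relations and the square root of the deformation factor -/

section QClifford

variable {A : Type} [Ring A] [Algebra ℂ A]

/-- The normalisation `c² (q + q⁻¹) q^{N+1-2j}` of `γ_j γ_{j'}`. -/
def scale (q c : ℂ) (N j : ℕ) : ℂ := c * (q + q⁻¹) * q ^ ((N : ℤ) + 1 - 2 * (j : ℤ))

/-- The right-hand side `1 + (q⁴ - 1) ∑_{k<j} γ_k γ_{k'} / s_k` of the relations between `γ_j` and
`γ_{j'}`. -/
def deform (q c : ℂ) (N : ℕ) (g : ℕ → A) (j : ℕ) : A :=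
  1 + (q ^ 4 - 1) • ∑ k ∈ Finset.Ico 1 j, (scale q c N k)⁻¹ • (g k * g (N + 1 - k))

/-- Elements satisfying the relations of the generators of `Cl_q(N)` in explicit form. -/
structure IsQClifford (q c : ℂ) (N : ℕ) (g : ℕ → A) : Prop where
  zero : g 0 = 0
  comm : ∀ i j, 1 ≤ i → i < j → j ≤ N → i + j ≠ N + 1 → g j * g i = (-q ^ 2) • (g i * g j)
  sq : ∀ i, 1 ≤ i → i ≤ N → 2 * i ≠ N + 1 → g i * g i = 0
  pair : ∀ i, 1 ≤ i → 2 * i ≤ N →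
    g i * g (N + 1 - i) + g (N + 1 - i) * g i = scale q c N i • deform q c N g i
  mid : ∀ i, 2 * i = N + 1 → g i * g i = c • deform q c N g i

/-- The inverse square root of `deform`. -/
def tau (q c : ℂ) (N : ℕ) (g : ℕ → A) : ℕ → A
  | 0 => 1
  | j + 1 => tau q c N g j * (1 + ((q ^ 2)⁻¹ - 1) • ((scale q c N j)⁻¹ •
      (tau q c N g j * tau q c N g j * (g j * g (N + 1 - j)))))

/-- The occupation number of the mode `j`. -/
def occ (q c : ℂ) (N : ℕ) (g : ℕ → A) (j : ℕ) : A :=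
  (scale q c N j)⁻¹ • (tau q c N g j * tau q c N g j * (g j * g (N + 1 - j)))

lemma tau_succ (q c : ℂ) (N : ℕ) (g : ℕ → A) (j : ℕ) :
    tau q c N g (j + 1) = tau q c N g j * (1 + ((q ^ 2)⁻¹ - 1) • occ q c N g j) := rfl

/-- The square root of `deform`. -/
def theta (q c : ℂ) (N : ℕ) (g : ℕ → A) : ℕ → A
  | 0 => 1
  | j + 1 => theta q c N g j * (1 + (q ^ 2 - 1) • occ q c N g j)

lemma theta_succ (q c : ℂ) (N : ℕ) (g : ℕ → A) (j : ℕ) :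
    theta q c N g (j + 1) = theta q c N g j * (1 + (q ^ 2 - 1) • occ q c N g j) := rfl

lemma deform_succ (q c : ℂ) (N : ℕ) (g : ℕ → A) {j : ℕ} (hj : 1 ≤ j) :
    deform q c N g (j + 1) =
      deform q c N g j + (q ^ 4 - 1) • ((scale q c N j)⁻¹ • (g j * g (N + 1 - j))) := by
  rw [deform, Finset.sum_Ico_succ_top hj, smul_add, ← add_assoc]
  rfl

lemma qcomm_mul {z a b : A} {μ ν : ℂ} (ha : z * a = μ • (a * z)) (hb : z * b = ν • (b * z)) :
    z * (a * b) = (μ * ν) • (a * b * z) := by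
  rw [← mul_assoc, ha, smul_mul_assoc, mul_assoc, hb, mul_smul_comm, smul_smul, mul_assoc]

lemma qcomm_symm {z a : A} {μ : ℂ} (hμ : μ ≠ 0) (ha : z * a = μ • (a * z)) :
    a * z = μ⁻¹ • (z * a) := by
  rw [ha, smul_smul, inv_mul_cancel₀ hμ, one_smul]

/-- The exponent of the commutation of `tau r` with `γ_k`. -/
def weight (N r k : ℕ) : ℤ := if k < r then -2 else if N + 1 - k < r then 2 else 0

/-- The properties of `tau` and `theta` that are proved by a joint induction. -/
structure TauSpec (q c : ℂ) (N : ℕ) (g : ℕ → A) (j : ℕ) : Prop where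
  theta_mul_tau : theta q c N g j * tau q c N g j = 1
  tau_mul_theta : tau q c N g j * theta q c N g j = 1
  theta_sq : theta q c N g j * theta q c N g j = deform q c N g j
  comm : ∀ k, 1 ≤ k → k ≤ N →
    tau q c N g j * g k = q ^ weight N j k • (g k * tau q c N g j)

namespace TauSpec

variable {q c : ℂ} {N : ℕ} {g : ℕ → A} {j : ℕ}

lemma tau_sq_mul_deform (s : TauSpec q c N g j) :
    tau q c N g j * tau q c N g j * deform q c N g j = 1 := by
  rw [← s.theta_sq, mul_assoc, ← mul_assoc _ (theta q c N g j), s.tau_mul_theta, one_mul,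
    s.tau_mul_theta]

lemma commute_self (s : TauSpec q c N g j) (hj : 1 ≤ j) (hj2 : 2 * j ≤ N + 1) :
    tau q c N g j * g j = g j * tau q c N g j := by
  have := s.comm j hj (by omega)
  rwa [show weight N j j = 0 by unfold weight; split_ifs <;> omega, zpow_zero, one_smul] at this

lemma commute_bar (s : TauSpec q c N g j) (hj : 1 ≤ j) (hj2 : 2 * j ≤ N + 1) :
    tau q c N g j * g (N + 1 - j) = g (N + 1 - j) * tau q c N g j := by
  have := s.comm (N + 1 - j) (by omega) (by omega)
  rwa [show weight N j (N + 1 - j) = 0 by unfold weight; split_ifs <;> omega, zpow_zero,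
    one_smul] at this

variable (s : TauSpec q c N g j) (h : IsQClifford q c N g) (hj : 1 ≤ j) (hj2 : 2 * j ≤ N)
  (hs : scale q c N j ≠ 0)
include s h hj hj2

omit h in
lemma tau_mul_occ : tau q c N g j * occ q c N g j = occ q c N g j * tau q c N g j := by
  have h1 := s.commute_self hj (by omega)
  have h2 := s.commute_bar hj (by omega)
  rw [occ, mul_smul_comm, smul_mul_assoc]
  congr 1
  simp only [mul_assoc]
  rw [← h2, ← mul_assoc (g j), ← h1, mul_assoc]

lemma mul_occ : g j * occ q c N g j = 0 := by
  have h1 := s.commute_self hj (by omega)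
  have e : g j * (tau q c N g j * tau q c N g j * (g j * g (N + 1 - j))) =
      tau q c N g j * tau q c N g j * (g j * g j * g (N + 1 - j)) := by
    simp only [← mul_assoc]
    rw [← h1, mul_assoc (tau q c N g j) (g j), ← h1, ← mul_assoc]
  rw [occ, mul_smul_comm, e, h.sq j hj (by omega) (by omega), zero_mul, mul_zero, smul_zero]

omit s in
lemma occ_mul_bar : occ q c N g j * g (N + 1 - j) = 0 := by
  rw [occ, smul_mul_assoc, mul_assoc, mul_assoc (g j), h.sq (N + 1 - j) (by omega) (by omega) (by omega)]
  simp

include hs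

/-- Replacing γ_j γ_{j'} by s_j D_j - γ_{j'} γ_j and using γ_j² = 0 leaves τ_j² D_j γ_j = γ_j. -/
lemma occ_mul : occ q c N g j * g j = g j := by
  have hp : g j * g (N + 1 - j) = scale q c N j • deform q c N g j - g (N + 1 - j) * g j := by
    rw [← h.pair j hj hj2]; abel
  rw [occ, hp, smul_mul_assoc, mul_assoc, sub_mul, mul_assoc _ (g j), h.sq j hj (by omega) (by omega),
    mul_zero, sub_zero, smul_mul_assoc, mul_smul_comm, smul_smul, inv_mul_cancel₀ hs, one_smul,
    ← mul_assoc, s.tau_sq_mul_deform, one_mul]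

lemma bar_mul_occ : g (N + 1 - j) * occ q c N g j = g (N + 1 - j) := by
  have h2 := s.commute_bar hj (by omega)
  have hp : g (N + 1 - j) * g j = scale q c N j • deform q c N g j - g j * g (N + 1 - j) := by
    rw [← h.pair j hj hj2]; abel
  have e : g (N + 1 - j) * (tau q c N g j * tau q c N g j * (g j * g (N + 1 - j))) =
      tau q c N g j * tau q c N g j * (g (N + 1 - j) * g j * g (N + 1 - j)) := by
    simp only [← mul_assoc]
    rw [← h2, mul_assoc _ (g (N + 1 - j)), ← h2, ← mul_assoc]
  rw [occ, mul_smul_comm, e, hp, sub_mul, mul_assoc (g j),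
    h.sq (N + 1 - j) (by omega) (by omega) (by omega), mul_zero, sub_zero, smul_mul_assoc,
    mul_smul_comm, smul_smul, inv_mul_cancel₀ hs, one_smul, ← mul_assoc, s.tau_sq_mul_deform,
    one_mul]

lemma occ_idem : occ q c N g j * occ q c N g j = occ q c N g j := by
  have h1 := s.tau_mul_occ hj hj2
  have h2 := s.occ_mul h hj hj2 hs
  have key : occ q c N g j * (tau q c N g j * tau q c N g j * (g j * g (N + 1 - j))) =
      tau q c N g j * tau q c N g j * (g j * g (N + 1 - j)) := by
    simp only [← mul_assoc]
    rw [← h1, mul_assoc _ _ (tau q c N g j), ← h1, ← mul_assoc, mul_assoc _ _ (g j), h2]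
  calc occ q c N g j * occ q c N g j
      = (scale q c N j)⁻¹ • (occ q c N g j *
          (tau q c N g j * tau q c N g j * (g j * g (N + 1 - j)))) := by
        rw [← mul_smul_comm]; rfl
    _ = occ q c N g j := by rw [key]; rfl

omit hs
-- Passing γ_k through γ_j γ_{j'} costs q⁻⁴, 1 or q⁴ according to whether k lies below j, between j
-- and j', or above j'; passing it through τ_j² costs exactly the inverse.
lemma occ_comm (hq : q ≠ 0) {k : ℕ} (hk : 1 ≤ k) (hkN : k ≤ N) (hkj : k ≠ j) (hkj' : k + j ≠ N + 1) :
    g k * occ q c N g j = occ q c N g j * g k := by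
  have hT := qcomm_symm (zpow_ne_zero _ hq) (s.comm k hk hkN)
  have hq2 : -q ^ 2 ≠ 0 := neg_ne_zero.2 (pow_ne_zero 2 hq)
  have key : ∃ μ ν : ℂ, g k * g j = μ • (g j * g k) ∧ g k * g (N + 1 - j) = ν • (g (N + 1 - j) * g k) ∧
      (q ^ weight N j k)⁻¹ * (q ^ weight N j k)⁻¹ * (μ * ν) = 1 := by
    have z4 : q ^ (2 : ℤ) = q ^ 2 := zpow_natCast q 2
    rcases lt_or_ge k j with h1 | h1
    · refine ⟨_, _, qcomm_symm hq2 (h.comm k j hk h1 (by omega) (by omega)),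
        qcomm_symm hq2 (h.comm k (N + 1 - j) hk (by omega) (by omega) (by omega)), ?_⟩
      rw [show weight N j k = -2 by unfold weight; split_ifs <;> omega, zpow_neg, z4]
      field_simp
    rcases lt_or_ge k (N + 1 - j) with h2 | h2
    · refine ⟨_, _, h.comm j k hj (by omega) (by omega) (by omega),
        qcomm_symm hq2 (h.comm k (N + 1 - j) hk (by omega) (by omega) (by omega)), ?_⟩
      rw [show weight N j k = 0 by unfold weight; split_ifs <;> omega, zpow_zero]
      field_simp
    · refine ⟨_, _, h.comm j k hj (by omega) (by omega) (by omega),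
        h.comm (N + 1 - j) k (by omega) (by omega) (by omega) (by omega), ?_⟩
      rw [show weight N j k = 2 by unfold weight; split_ifs <;> omega, z4]
      field_simp
  obtain ⟨μ, ν, h1, h2, h3⟩ := key
  have := qcomm_mul (qcomm_mul hT hT) (qcomm_mul h1 h2)
  rw [h3, one_smul] at this
  rw [occ, mul_smul_comm, this, smul_mul_assoc]

include hs
-- The properties must be proved jointly: idempotence of n_j rests on τ_j² D_j = 1 and on the
-- commutation rules of τ_j, and it in turn yields both for j + 1.
lemma succ (hq : q ≠ 0) : TauSpec q c N g (j + 1) := by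
  have hidem := s.occ_idem h hj hj2 hs
  have hte := s.tau_mul_occ hj hj2
  have hq2 : q ^ 2 ≠ 0 := pow_ne_zero 2 hq
  have hthe : theta q c N g j * occ q c N g j = occ q c N g j * theta q c N g j := by
    calc theta q c N g j * occ q c N g j
        = theta q c N g j * (occ q c N g j * tau q c N g j) * theta q c N g j := by
          rw [mul_assoc, mul_assoc, s.tau_mul_theta, mul_one]
      _ = _ := by rw [← hte, ← mul_assoc, s.theta_mul_tau, one_mul]
  have c1 : ∀ a : ℂ, Commute (theta q c N g j) (1 + a • occ q c N g j) := fun a =>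
    (Commute.one_right _).add_right ((show Commute _ _ from hthe).smul_right a)
  have c2 : ∀ a : ℂ, Commute (tau q c N g j) (1 + a • occ q c N g j) := fun a =>
    (Commute.one_right _).add_right ((show Commute _ _ from hte).smul_right a)
  have e1 : ∀ a b : ℂ, (1 + a • occ q c N g j) * (1 + b • occ q c N g j) =
      1 + (a + b + a * b) • occ q c N g j := fun a b => by
    simp only [mul_add, add_mul, one_mul, mul_one, smul_mul_smul_comm, hidem]
    module
  refine ⟨?_, ?_, ?_, fun k hk hkN => ?_⟩
  · rw [theta_succ, tau_succ, mul_assoc, ← mul_assoc _ (tau q c N g j), ← (c2 _).eq, mul_assoc,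
      ← mul_assoc, s.theta_mul_tau, one_mul, e1]
    have : q ^ 2 - 1 + ((q ^ 2)⁻¹ - 1) + (q ^ 2 - 1) * ((q ^ 2)⁻¹ - 1) = 0 := by field_simp; ring
    rw [this, zero_smul, add_zero]
  · rw [theta_succ, tau_succ, mul_assoc, ← mul_assoc _ (theta q c N g j), ← (c1 _).eq, mul_assoc,
      ← mul_assoc, s.tau_mul_theta, one_mul, e1]
    have : (q ^ 2)⁻¹ - 1 + (q ^ 2 - 1) + ((q ^ 2)⁻¹ - 1) * (q ^ 2 - 1) = 0 := by field_simp; ring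
    rw [this, zero_smul, add_zero]
  -- Idempotence gives (1 + (q² - 1) n_j)² = 1 + (q⁴ - 1) n_j, and D_j n_j is the new summand of
  -- D_{j+1} up to the factor q⁴ - 1.
  · rw [theta_succ, mul_assoc, ← mul_assoc _ (theta q c N g j), ← (c1 _).eq, mul_assoc,
      ← mul_assoc, s.theta_sq, e1, deform_succ q c N g hj, mul_add, mul_one, mul_smul_comm, occ]
    have : deform q c N g j * (tau q c N g j * tau q c N g j * (g j * g (N + 1 - j))) =
        g j * g (N + 1 - j) := by
      rw [← s.theta_sq, ← mul_assoc, mul_assoc (theta q c N g j), ← mul_assoc _ (tau q c N g j),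
        s.theta_mul_tau, one_mul, s.theta_mul_tau, one_mul]
    rw [mul_smul_comm, this]
    congr 2
    ring
  · rw [tau_succ]
    have hmul : ∀ a : ℂ, (1 + a • occ q c N g j) * g k = g k + a • (occ q c N g j * g k) := fun a => by
      rw [add_mul, one_mul, smul_mul_assoc]
    have hmul' : ∀ a : ℂ, g k * (1 + a • occ q c N g j) = g k + a • (g k * occ q c N g j) := fun a => by
      rw [mul_add, mul_one, mul_smul_comm]
    have hc := s.comm k hk hkN
    -- Only k = j and k = j' change weight: the new factor of τ_{j+1} acts as q⁻² to the left of γ_j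
    -- and as 1 to its right, and the other way round for γ_{j'}.
    by_cases hkj : k = j
    · subst hkj
      rw [show weight N (k + 1) k = -2 by unfold weight; split_ifs <;> omega]
      rw [show weight N k k = 0 by unfold weight; split_ifs <;> omega, zpow_zero, one_smul] at hc
      rw [mul_assoc, hmul, s.occ_mul h hj hj2 hs, ← mul_assoc (g k), ← hc, mul_assoc _ (g k), hmul',
        s.mul_occ h hj hj2, smul_zero, add_zero, mul_add, mul_smul_comm,
        zpow_neg, show q ^ (2 : ℤ) = q ^ 2 from zpow_natCast q 2]
      module
    by_cases hkj' : k = N + 1 - j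
    · rw [show weight N (j + 1) k = 2 by unfold weight; split_ifs <;> omega]
      rw [show weight N j k = 0 by unfold weight; split_ifs <;> omega, zpow_zero, one_smul] at hc
      rw [mul_assoc, hmul, ← mul_assoc (g k), ← hc, mul_assoc _ (g k), hmul', hkj',
        s.bar_mul_occ h hj hj2 hs, occ_mul_bar h hj hj2, smul_zero, add_zero, mul_add,
        mul_smul_comm, show q ^ (2 : ℤ) = q ^ 2 from zpow_natCast q 2, smul_add, smul_smul, mul_sub,
        mul_inv_cancel₀ hq2]
      module
    · have := s.occ_comm h hj hj2 hq hk hkN hkj (by omega)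
      rw [show weight N (j + 1) k = weight N j k by unfold weight; split_ifs <;> omega, mul_assoc,
        hmul, ← this, ← hmul', ← mul_assoc, hc, smul_mul_assoc, mul_assoc]

end TauSpec

namespace IsQClifford

variable {q c : ℂ} {N : ℕ} {g : ℕ → A} (h : IsQClifford q c N g)
include h

lemma occ_zero : occ q c N g 0 = 0 := by simp [occ, h.zero]

/-- The index 0 is a dummy: γ_0 = 0 makes n_0 = 0, so τ_1 = 1. The range reaches N/2 + 1, as needed
for the middle generator and for sums over all lower indices. -/
lemma tauSpec (hq : q ≠ 0) (hs : ∀ k, scale q c N k ≠ 0) {j : ℕ} (hj : 1 ≤ j) (hj2 : 2 * j ≤ N + 2) :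
    TauSpec q c N g j := by
  induction j, hj using Nat.le_induction with
  | base =>
    have h1 : tau q c N g 1 = 1 := by rw [tau_succ, h.occ_zero, tau]; simp
    have h2 : theta q c N g 1 = 1 := by rw [theta_succ, h.occ_zero, theta]; simp
    refine ⟨by simp [h1, h2], by simp [h1, h2], by simp [h2, deform], fun k hk hkN => ?_⟩
    rw [show weight N 1 k = 0 by unfold weight; split_ifs <;> omega]
    simp [h1]
  | succ j hj ih => exact (ih (by omega)).succ h hj (by omega) (hs j) hq

end IsQClifford

end QClifford

/-! ### Fermions inside the q-Clifford algebra -/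

section Modes

variable {A : Type} [Ring A] [Algebra ℂ A]

/-- The fermionic generators obtained from the `γ_k` by dressing with `tau`. -/
def psi (q c : ℂ) (N : ℕ) (g : ℕ → A) (k : ℕ) : A := tau q c N g (min k (N + 1 - k)) * g k

/-- The index of the generator that underlies the mode `a`. -/
def modeIndex (N : ℕ) (a : ℤ) : ℕ :=
  if 0 < a then a.natAbs else if a < 0 then N + 1 - a.natAbs
  else if N % 2 = 1 then N / 2 + 1 else 0

/-- The normalisation of the mode `a`. -/
def modeScale (q c : ℂ) (N : ℕ) (a : ℤ) : ℂ := if a < 0 then (scale q c N a.natAbs)⁻¹ else 1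

/-- The modes `x_a`, which satisfy the canonical anticommutation relations. -/
def mode (q c : ℂ) (N : ℕ) (g : ℕ → A) (a : ℤ) : A :=
  modeScale q c N a • psi q c N g (modeIndex N a)

/-- The product of the elements `1 + (μ_j - 1) occ_j` for `1 ≤ j ≤ m`. -/
def prodGrp (q c : ℂ) (N : ℕ) (g : ℕ → A) (μ : ℕ → ℂ) : ℕ → A
  | 0 => 1
  | m + 1 => prodGrp q c N g μ m * (1 + (μ (m + 1) - 1) • occ q c N g (m + 1))

lemma prodGrp_eq_one {q c : ℂ} {N : ℕ} {g : ℕ → A} {μ : ℕ → ℂ} {m : ℕ}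
    (hμ : ∀ j, 1 ≤ j → j ≤ m → μ j = 1) : prodGrp q c N g μ m = 1 := by
  induction m with
  | zero => rfl
  | succ m ih =>
    rw [prodGrp, ih fun j h1 h2 => hμ j h1 (by omega), hμ (m + 1) (by omega) le_rfl]
    simp

namespace IsQClifford

variable {q c : ℂ} {N : ℕ} {g : ℕ → A} (h : IsQClifford q c N g)
include h

/-- An element that q-commutes with γ_k and γ_{k'} by inverse factors commutes with γ_k γ_{k'}, and
τ_j is built from these products with k < j. -/
lemma commute_tau {z : A} {j : ℕ} (hz : ∀ k, 1 ≤ k → k < j → ∃ μ : ℂ, μ ≠ 0 ∧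
    z * g k = μ • (g k * z) ∧ z * g (N + 1 - k) = μ⁻¹ • (g (N + 1 - k) * z)) :
    z * tau q c N g j = tau q c N g j * z := by
  induction j with
  | zero => simp [tau]
  | succ j ih =>
    have hj := ih fun k h1 h2 => hz k h1 (by omega)
    rw [tau_succ]
    rcases Nat.eq_zero_or_pos j with rfl | hj0
    · rw [h.occ_zero]; simp [tau]
    obtain ⟨μ, hμ, h1, h2⟩ := hz j hj0 (by omega)
    have hj' : z * tau q c N g j = (1 : ℂ) • (tau q c N g j * z) := by rw [one_smul, hj]
    have h3 := qcomm_mul (qcomm_mul hj' hj') (qcomm_mul h1 h2)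
    rw [one_mul, one_mul, mul_inv_cancel₀ hμ, one_smul] at h3
    have h4 : Commute z (1 + ((q ^ 2)⁻¹ - 1) • occ q c N g j) := by
      refine (Commute.one_right _).add_right (Commute.smul_right ?_ _)
      exact Commute.smul_right h3 _
    exact (show Commute _ _ from hj).mul_right h4

variable (hq : q ≠ 0) (hs : ∀ k, scale q c N k ≠ 0)
include hq hs

lemma tau_comm_tau {i j : ℕ} (hi : 1 ≤ i) (hi2 : 2 * i ≤ N + 2) (hj2 : 2 * j ≤ N + 2) :
    tau q c N g i * tau q c N g j = tau q c N g j * tau q c N g i := by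
  refine h.commute_tau fun k hk hkj => ⟨q ^ weight N i k, zpow_ne_zero _ hq, ?_, ?_⟩
  · exact (h.tauSpec hq hs hi hi2).comm k hk (by omega)
  · rw [(h.tauSpec hq hs hi hi2).comm (N + 1 - k) (by omega) (by omega), ← zpow_neg]
    congr 2
    unfold weight
    split_ifs <;> omega

omit hq hs in
lemma psi_zero : psi q c N g 0 = 0 := by simp [psi, h.zero]

lemma psi_anti_of_lt {k l : ℕ} (hk : 1 ≤ k) (hkl : k < l) (hl : l ≤ N) (hkl' : k + l ≠ N + 1) :
    psi q c N g k * psi q c N g l = -(psi q c N g l * psi q c N g k) := by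
  unfold psi
  set p := min k (N + 1 - k) with hp
  set r := min l (N + 1 - l) with hr
  have sp := h.tauSpec hq hs (j := p) (by omega) (by omega)
  have sr := h.tauSpec hq hs (j := r) (by omega) (by omega)
  have e1 := qcomm_symm (zpow_ne_zero _ hq) (sr.comm k hk (by omega))
  have e2 := qcomm_symm (zpow_ne_zero _ hq) (sp.comm l (by omega) hl)
  have t := h.tau_comm_tau hq hs (i := p) (j := r) (by omega) (by omega) (by omega)
  -- The powers of q from moving each generator past the other's τ differ by exactly q², which turns
  -- the factor -q² of the generators into -1.
  have hcoef : (q ^ weight N r k)⁻¹ = (q ^ weight N p l)⁻¹ * q ^ 2 := by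
    rw [← zpow_neg, ← zpow_neg, ← zpow_natCast q 2, ← zpow_add₀ hq]
    congr 1
    unfold weight
    split_ifs <;> push_cast <;> omega
  calc tau q c N g p * g k * (tau q c N g r * g l)
      = tau q c N g p * (g k * tau q c N g r) * g l := by simp only [mul_assoc]
    _ = (q ^ weight N r k)⁻¹ • (tau q c N g p * tau q c N g r * (g k * g l)) := by
      rw [e1, mul_smul_comm, smul_mul_assoc]; simp only [mul_assoc]
    _ = -((q ^ weight N p l)⁻¹ • (tau q c N g r * tau q c N g p * (g l * g k))) := by
      rw [h.comm k l hk hkl hl hkl', t, mul_smul_comm, smul_smul, hcoef]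
      module
    _ = -(tau q c N g r * (g l * tau q c N g p) * g k) := by
      rw [e2, mul_smul_comm, smul_mul_assoc]; simp only [mul_assoc]
    _ = _ := by simp only [mul_assoc]

lemma psi_sq {k : ℕ} (hk : 1 ≤ k) (hkN : k ≤ N) (hkk : 2 * k ≠ N + 1) :
    psi q c N g k * psi q c N g k = 0 := by
  unfold psi
  set p := min k (N + 1 - k) with hp
  have sp := h.tauSpec hq hs (j := p) (by omega) (by omega)
  have e := sp.comm k hk hkN
  rw [show weight N p k = 0 by unfold weight; split_ifs <;> omega, zpow_zero, one_smul] at e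
  rw [e, mul_assoc, ← mul_assoc _ (g k), e, mul_assoc (g k), ← mul_assoc, h.sq k hk hkN hkk, zero_mul]

lemma psi_anti {k l : ℕ} (hk : k ≤ N) (hl : l ≤ N) (hkl : k + l ≠ N + 1) :
    psi q c N g k * psi q c N g l = -(psi q c N g l * psi q c N g k) := by
  rcases Nat.eq_zero_or_pos k with rfl | hk0
  · simp [h.psi_zero]
  rcases Nat.eq_zero_or_pos l with rfl | hl0
  · simp [h.psi_zero]
  rcases lt_trichotomy k l with hlt | rfl | hlt
  · exact h.psi_anti_of_lt hq hs hk0 hlt hl hkl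
  · rw [h.psi_sq hq hs hk0 hk (by omega), neg_zero]
  · rw [h.psi_anti_of_lt hq hs hl0 hlt hk (by omega), neg_neg]

lemma psi_mul_bar {k : ℕ} (hk : 1 ≤ k) (hk2 : 2 * k ≤ N) :
    psi q c N g k * psi q c N g (N + 1 - k) =
      tau q c N g k * tau q c N g k * (g k * g (N + 1 - k)) := by
  have s := h.tauSpec hq hs hk (by omega)
  rw [psi, psi, show min k (N + 1 - k) = k by omega,
    show min (N + 1 - k) (N + 1 - (N + 1 - k)) = k by omega, mul_assoc, ← mul_assoc (g k),
    ← s.commute_self hk (by omega)]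
  simp only [mul_assoc]

lemma bar_mul_psi {k : ℕ} (hk : 1 ≤ k) (hk2 : 2 * k ≤ N) :
    psi q c N g (N + 1 - k) * psi q c N g k =
      tau q c N g k * tau q c N g k * (g (N + 1 - k) * g k) := by
  have s := h.tauSpec hq hs hk (by omega)
  rw [psi, psi, show min k (N + 1 - k) = k by omega,
    show min (N + 1 - k) (N + 1 - (N + 1 - k)) = k by omega, mul_assoc, ← mul_assoc (g (N + 1 - k)),
    ← s.commute_bar hk (by omega)]
  simp only [mul_assoc]

lemma psi_pair {k : ℕ} (hk : 1 ≤ k) (hk2 : 2 * k ≤ N) :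
    psi q c N g k * psi q c N g (N + 1 - k) + psi q c N g (N + 1 - k) * psi q c N g k =
      scale q c N k • 1 := by
  have s := h.tauSpec hq hs hk (by omega)
  rw [h.psi_mul_bar hq hs hk hk2, h.bar_mul_psi hq hs hk hk2, ← mul_add, h.pair k hk hk2,
    mul_smul_comm, s.tau_sq_mul_deform]

/-- Opposite modes have indices adding up to N + 1, and only the negative one carries 1 / s, which
normalises the pairing. For even N the mode 0 has index 0 and is zero, so its relations hold
trivially. -/
lemma isCAR_mode : IsCAR (N / 2) (mode q c N g) where
  anti a b ha hb hab := by
    have hidx : ∀ a : ℤ, a.natAbs ≤ N / 2 → modeIndex N a ≤ N := fun a ha => by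
      unfold modeIndex; split_ifs <;> omega
    have := h.psi_anti hq hs (hidx a ha) (hidx b hb) (by
      unfold modeIndex; split_ifs <;> omega)
    rw [mode, mode, smul_mul_smul_comm, smul_mul_smul_comm, this, mul_comm (modeScale q c N a),
      smul_neg]
  pair a ha ha0 := by
    have e : modeScale q c N a * modeScale q c N (-a) = (scale q c N a.natAbs)⁻¹ := by
      unfold modeScale
      split_ifs
      · omega
      · rw [mul_one]
      · rw [Int.natAbs_neg, one_mul]
      · omega
    have := h.psi_pair hq hs (k := a.natAbs) (by omega) (by omega)
    rw [mode, mode, smul_mul_smul_comm, smul_mul_smul_comm, mul_comm (modeScale q c N (-a)), e,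
      ← smul_add]
    rcases lt_or_gt_of_ne ha0 with h1 | h1
    · rw [show modeIndex N a = N + 1 - a.natAbs by unfold modeIndex; split_ifs <;> omega,
        show modeIndex N (-a) = a.natAbs by unfold modeIndex; split_ifs <;> omega, add_comm, this,
        smul_smul, inv_mul_cancel₀ (hs _), one_smul]
    · rw [show modeIndex N a = a.natAbs by unfold modeIndex; split_ifs <;> omega,
        show modeIndex N (-a) = N + 1 - a.natAbs by unfold modeIndex; split_ifs <;> omega, this,
        smul_smul, inv_mul_cancel₀ (hs _), one_smul]

lemma mode_zero_sq (hN : N % 2 = 1) : mode q c N g 0 * mode q c N g 0 = c • 1 := by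
  have s := h.tauSpec hq hs (j := N / 2 + 1) (by omega) (by omega)
  have e := s.comm (N / 2 + 1) (by omega) (by omega)
  rw [show weight N (N / 2 + 1) (N / 2 + 1) = 0 by unfold weight; split_ifs <;> omega, zpow_zero,
    one_smul] at e
  rw [mode, show modeIndex N 0 = N / 2 + 1 by unfold modeIndex; split_ifs <;> omega,
    show modeScale q c N 0 = 1 by simp [modeScale], one_smul, psi,
    show min (N / 2 + 1) (N + 1 - (N / 2 + 1)) = N / 2 + 1 by omega, mul_assoc,
    ← mul_assoc (g (N / 2 + 1)), ← e, mul_assoc, ← mul_assoc, h.mid (N / 2 + 1) (by omega),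
    mul_smul_comm, s.tau_sq_mul_deform]

lemma mode_mul_neg {k : ℕ} (hk : 1 ≤ k) (hk2 : 2 * k ≤ N) :
    mode q c N g k * mode q c N g (-k) = occ q c N g k := by
  rw [mode, mode, show modeIndex N k = k by unfold modeIndex; split_ifs <;> omega,
    show modeIndex N (-k) = N + 1 - k by unfold modeIndex; split_ifs <;> omega,
    show modeScale q c N k = 1 by unfold modeScale; split_ifs <;> first | rfl | omega,
    show modeScale q c N (-k) = (scale q c N k)⁻¹ by
      unfold modeScale; split_ifs <;> first | omega | simp,
    one_smul, mul_smul_comm, h.psi_mul_bar hq hs hk hk2, occ]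

/-- Since γ_j n_j = 0, the last factor of τ_{j+1} disappears to the right of γ_j. This puts products
of two modes into the form τ_j² γ γ produced by the sums for F_i. -/
lemma lower_mul_tau_succ {j : ℕ} (hj : 1 ≤ j) (hj2 : 2 * j ≤ N) (z : A) :
    tau q c N g j * g j * (tau q c N g (j + 1) * z) =
      tau q c N g j * tau q c N g j * (g j * z) := by
  have s := h.tauSpec hq hs hj (by omega)
  have e : g j * tau q c N g (j + 1) = tau q c N g j * g j := by
    rw [tau_succ, ← mul_assoc, ← s.commute_self hj (by omega), mul_assoc, mul_add, mul_one,
      mul_smul_comm, s.mul_occ h hj hj2, smul_zero, add_zero]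
  rw [mul_assoc, ← mul_assoc (g j), e]
  simp only [mul_assoc]

/-- The counterpart for E_i: n_j γ_{j'} = 0 removes the last factor of τ_{j+1}, once γ_k, which has
weight 0 for both τ's, is moved out of the way. -/
lemma tau_succ_mul_upper {j k : ℕ} (hj : 1 ≤ j) (hj2 : 2 * j ≤ N) (hk : j < k) (hk2 : k + j ≤ N) :
    tau q c N g (j + 1) * g k * (tau q c N g j * g (N + 1 - j)) =
      tau q c N g j * tau q c N g j * (g k * g (N + 1 - j)) := by
  have s := h.tauSpec hq hs hj (by omega)
  have s' := h.tauSpec hq hs (j := j + 1) (by omega) (by omega)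
  have e := s.comm k (by omega) (by omega)
  have e' := s'.comm k (by omega) (by omega)
  rw [show weight N j k = 0 by unfold weight; split_ifs <;> omega, zpow_zero, one_smul] at e
  rw [show weight N (j + 1) k = 0 by unfold weight; split_ifs <;> omega, zpow_zero, one_smul] at e'
  have t := h.tau_comm_tau hq hs (i := j + 1) (j := j) (by omega) (by omega) (by omega)
  have u : tau q c N g (j + 1) * g (N + 1 - j) = tau q c N g j * g (N + 1 - j) := by
    rw [tau_succ, mul_assoc, add_mul, one_mul, smul_mul_assoc, TauSpec.occ_mul_bar h hj hj2,
      smul_zero, add_zero]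
  calc tau q c N g (j + 1) * g k * (tau q c N g j * g (N + 1 - j))
      = tau q c N g (j + 1) * (g k * tau q c N g j) * g (N + 1 - j) := by simp only [mul_assoc]
    _ = (tau q c N g (j + 1) * tau q c N g j) * g k * g (N + 1 - j) := by
      rw [← e]; simp only [mul_assoc]
    _ = tau q c N g j * (tau q c N g (j + 1) * g k) * g (N + 1 - j) := by
      rw [t]; simp only [mul_assoc]
    _ = tau q c N g j * (g k * (tau q c N g (j + 1) * g (N + 1 - j))) := by
      rw [e']; simp only [mul_assoc]
    _ = tau q c N g j * (g k * tau q c N g j) * g (N + 1 - j) := by rw [u]; simp only [mul_assoc]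
    _ = _ := by rw [← e]; simp only [mul_assoc]

/-- By idempotence of n_j, τ_{m+1}² is the product of 1 + (q⁻⁴ - 1) n_j, and multiplying by such a
factor rescales μ_j by q⁻⁴. -/
lemma prodGrp_mul_tau_sq (μ : ℕ → ℂ) {m : ℕ} (hm : 2 * m ≤ N) :
    prodGrp q c N g μ m * (tau q c N g (m + 1) * tau q c N g (m + 1)) =
      prodGrp q c N g (fun j => (q ^ 4)⁻¹ * μ j) m := by
  induction m with
  | zero =>
    have h1 : tau q c N g (0 + 1) = 1 := by rw [tau_succ, h.occ_zero, tau]; simp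
    simp [prodGrp, h1]
  | succ m ih =>
    have s := h.tauSpec hq hs (j := m + 1) (by omega) (by omega)
    have hidem := s.occ_idem h (by omega) hm (hs _)
    have c2 : ∀ a : ℂ, Commute (tau q c N g (m + 1)) (1 + a • occ q c N g (m + 1)) := fun a =>
      (Commute.one_right _).add_right
        ((show Commute _ _ from s.tau_mul_occ (by omega) hm).smul_right a)
    have e1 : ∀ a b : ℂ, (1 + a • occ q c N g (m + 1)) * (1 + b • occ q c N g (m + 1)) =
        1 + (a + b + a * b) • occ q c N g (m + 1) := fun a b => by
      simp only [mul_add, add_mul, one_mul, mul_one, smul_mul_smul_comm, hidem]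
      module
    rw [prodGrp, prodGrp, ← ih (by omega), tau_succ q c N g (m + 1)]
    rw [mul_assoc (tau q c N g (m + 1)), ← mul_assoc _ (tau q c N g (m + 1)) (1 + _), ← (c2 _).eq,
      mul_assoc (tau q c N g (m + 1)) _ (1 + _), e1, mul_assoc, ← mul_assoc (1 + _), ← (c2 _).eq,
      mul_assoc (tau q c N g (m + 1)) (1 + _), ← mul_assoc (1 + _), ← (c2 _).eq,
      mul_assoc (tau q c N g (m + 1)) (1 + _), e1]
    simp only [← mul_assoc]
    congr 3
    have : q ^ 2 ≠ 0 := pow_ne_zero 2 hq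
    field_simp
    ring

end IsQClifford

end Modes

/-! ### Evaluation of the ordered sums -/

section OrderedSum

variable {A : Type} [Ring A] [Algebra ℂ A]

/-- The sum `S_m(f; mid)` for arbitrary elements `g` in place of the generators `γ`. -/
def osum (q c : ℂ) (N : ℕ) (g : ℕ → A) (m : ℕ) (f : ℕ → ℕ → ℕ → ℂ) (mid : A) : A :=
  ∑ J ∈ (Finset.Icc 1 m).powerset,
    (∏ r ∈ Finset.Icc 1 J.card,
      f J.card r (J.sort.getD (r - 1) 0) / scale q c N (J.sort.getD (r - 1) 0)) •
      ((J.sort.map g).prod * mid * (J.sort.reverse.map (fun j => g (N + 1 - j))).prod)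

lemma orderedSum_eq_osum (q c2 : ℂ) (N m : ℕ) (f : ℕ → ℕ → ℕ → ℂ) (mid : Cl q c2 N) :
    orderedSum q c2 N m f mid = osum q c2 N (γ q c2 N) m f mid := by
  rw [osum, Finset.sum_powerset, orderedSum, Nat.card_Icc, Nat.add_sub_cancel]
  refine Finset.sum_congr rfl fun l _ => Finset.sum_congr rfl fun J hJ => ?_
  rw [(Finset.mem_powersetCard.1 hJ).2]
  rfl

lemma sort_insert_max {m : ℕ} {J : Finset ℕ} (hJ : ∀ j ∈ J, j ≤ m) :
    (insert (m + 1) J).sort = J.sort ++ [m + 1] := by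
  have hmem : m + 1 ∉ J := fun h => absurd (hJ _ h) (by omega)
  refine List.Perm.eq_of_pairwise' (r := (· ≤ ·)) (Finset.pairwise_sort _ _) ?_ ?_
  · rw [List.pairwise_append]
    refine ⟨Finset.pairwise_sort _ _, by simp, fun a ha b hb => ?_⟩
    rw [List.mem_singleton] at hb
    have := hJ a ((Finset.mem_sort _).1 ha)
    omega
  · rw [← Multiset.coe_eq_coe, ← Multiset.coe_add, Finset.sort_eq, Finset.sort_eq,
      Finset.insert_val_of_notMem hmem, add_comm J.val]
    rfl

/-- The subsets of {1, …, m+1} are split by membership of m + 1. As the largest index it stands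
innermost, so γ_{m+1} and its partner are absorbed into the middle factor and l is shifted by one.
-/
lemma osum_succ (q c : ℂ) (N : ℕ) (g : ℕ → A) (m : ℕ) (f : ℕ → ℕ → ℕ → ℂ) (mid : A) (a : ℂ)
    (hf : ∀ l, f (l + 1) (l + 1) (m + 1) = a) :
    osum q c N g (m + 1) f mid = osum q c N g m f mid +
      (a / scale q c N (m + 1)) •
        osum q c N g m (fun l r j => f (l + 1) r j) (g (m + 1) * mid * g (N + 1 - (m + 1))) := by
  have hIcc : Finset.Icc 1 (m + 1) = insert (m + 1) (Finset.Icc 1 m) := by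
    ext; simp; omega
  have hnot : m + 1 ∉ Finset.Icc 1 m := by simp
  rw [osum, hIcc, Finset.sum_powerset_insert hnot]
  congr 1
  rw [osum, Finset.smul_sum]
  refine Finset.sum_congr rfl fun J hJ => ?_
  rw [Finset.mem_powerset] at hJ
  have hle : ∀ j ∈ J, j ≤ m := fun j hj => (Finset.mem_Icc.1 (hJ hj)).2
  have hmem : m + 1 ∉ J := fun h => hnot (hJ h)
  rw [sort_insert_max hle, Finset.card_insert_of_notMem hmem, Finset.prod_Icc_succ_top (by omega),
    smul_smul]
  congr 1
  · rw [mul_comm]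
    congr 1
    · rw [Nat.add_sub_cancel, List.getD_append_right _ _ _ _ (by simp), Finset.length_sort,
        Nat.sub_self, List.getD_cons_zero, hf]
    · refine Finset.prod_congr rfl fun r hr => ?_
      rw [Finset.mem_Icc] at hr
      rw [List.getD_append _ _ _ _ (by rw [Finset.length_sort]; omega)]
  · simp [mul_assoc]

/-- The parameter b makes the induction close: absorbing γ_{m+1} and its partner into `mid`
multiplies both the numerator parameter and the commutation factor with the upper generators by
matching powers, b becoming b q⁴. -/
theorem IsQClifford.osum_eq {q c : ℂ} {N : ℕ} {g : ℕ → A} (h : IsQClifford q c N g) (hq : q ≠ 0)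
    (hs : ∀ k, scale q c N k ≠ 0) (μ : ℕ → ℂ) {m : ℕ} (hm : 2 * m ≤ N) {b : ℂ} (hb : b ≠ 0)
    {mid : A} (hmid : ∀ k, 1 ≤ k → k ≤ m →
      mid * g (N + 1 - k) = b⁻¹ • (g (N + 1 - k) * mid)) :
    osum q c N g m (fun l r j => μ j - b * q ^ (4 * (l : ℤ) - 4 * r)) mid =
      prodGrp q c N g (fun j => b⁻¹ * μ j) m * mid := by
  induction m generalizing b mid with
  | zero => simp [osum, prodGrp]
  | succ m ih =>
    have hq2 : -q ^ 2 ≠ 0 := neg_ne_zero.2 (pow_ne_zero 2 hq)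
    have hq4 : q ^ 4 ≠ 0 := pow_ne_zero 4 hq
    rw [osum_succ q c N g m _ mid (μ (m + 1) - b) (fun l => by simp)]
    rw [ih (by omega) hb fun k h1 h2 => hmid k h1 (by omega)]
    have hfun : (fun l r j => μ j - b * q ^ (4 * ((l + 1 : ℕ) : ℤ) - 4 * r) : ℕ → ℕ → ℕ → ℂ) =
        fun (l r j : ℕ) => μ j - (b * q ^ 4) * q ^ (4 * (l : ℤ) - 4 * r) := by
      funext l r j
      rw [mul_assoc, ← zpow_natCast q 4, ← zpow_add₀ hq]
      congr 3
      push_cast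
      ring
    rw [hfun, ih (by omega) (mul_ne_zero hb hq4)]
    · have s := h.tauSpec hq hs (j := m + 1) (by omega) (by omega)
      -- The change from b to b q⁴ amounts to a factor τ_{m+1}², just what γ_{m+1} γ_{(m+1)'} /
      -- s_{m+1} needs to become n_{m+1}.
      have hP : prodGrp q c N g (fun j => (b * q ^ 4)⁻¹ * μ j) m =
          prodGrp q c N g (fun j => b⁻¹ * μ j) m *
            (tau q c N g (m + 1) * tau q c N g (m + 1)) := by
        rw [h.prodGrp_mul_tau_sq hq hs _ (by omega)]
        congr 1
        funext j
        rw [mul_inv]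
        ring
      rw [hP, mul_assoc (g (m + 1)), hmid (m + 1) (by omega) le_rfl, mul_smul_comm, mul_smul_comm,
        smul_smul, prodGrp, mul_assoc _ _ mid, add_mul, one_mul, mul_add, occ]
      congr 1
      simp only [smul_mul_assoc, mul_smul_comm, smul_smul, mul_assoc]
      congr 1
      field_simp
    · intro k h1 h2
      have e1 := qcomm_symm hq2 (h.comm (m + 1) (N + 1 - k) (by omega) (by omega) (by omega) (by omega))
      have e2 := qcomm_symm hq2 (h.comm (N + 1 - (m + 1)) (N + 1 - k) (by omega) (by omega) (by omega)
        (by omega))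
      rw [mul_assoc, e2, mul_smul_comm, mul_assoc (g (m + 1)), ← mul_assoc mid,
        hmid k h1 (by omega), smul_mul_assoc, mul_smul_comm, mul_assoc, ← mul_assoc (g (m + 1)), e1,
        smul_mul_assoc]
      simp only [smul_smul, mul_assoc]
      congr 1
      field_simp

/-- The sums in the images of the root vectors. -/
theorem IsQClifford.osum_root {q c : ℂ} {N : ℕ} {g : ℕ → A} (h : IsQClifford q c N g) (hq : q ≠ 0)
    (hs : ∀ k, scale q c N k ≠ 0) {m a b : ℕ} (hm : 2 * m ≤ N) (ha : m < a) (ha' : a + m ≤ N)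
    (hb : m < b) (hb' : b + m ≤ N) :
    osum q c N g m (fun _ r _ => 1 - q ^ (4 * r)) (g a * g b) =
      tau q c N g (m + 1) * tau q c N g (m + 1) * (g a * g b) := by
  have hq2 : -q ^ 2 ≠ 0 := neg_ne_zero.2 (pow_ne_zero 2 hq)
  have hq4 : q ^ 4 ≠ 0 := pow_ne_zero 4 hq
  -- Each of γ_a and γ_b contributes (-q²)⁻¹ when passing an outer upper generator, hence b = q⁴;
  -- the resulting numerators are 1 - q^{4(l+1-r)}.
  have key := h.osum_eq hq hs (fun _ => 1) hm (b := q ^ 4) hq4 (mid := g a * g b) fun k h1 h2 => by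
    have e1 := qcomm_symm hq2 (h.comm a (N + 1 - k) (by omega) (by omega) (by omega) (by omega))
    have e2 := qcomm_symm hq2 (h.comm b (N + 1 - k) (by omega) (by omega) (by omega) (by omega))
    rw [mul_assoc, e2, mul_smul_comm, ← mul_assoc, e1, smul_mul_assoc, smul_smul, mul_assoc]
    congr 1
    field_simp
  rw [← h.prodGrp_mul_tau_sq hq hs (fun _ => 1) hm, prodGrp_eq_one fun _ _ _ => rfl, one_mul] at key
  rw [← key, osum, osum]
  refine Finset.sum_congr rfl fun J _ => ?_
  congr 1
  rw [Finset.prod_div_distrib, Finset.prod_div_distrib]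
  congr 1
  -- These numerators do not depend on j_r, so reversing r turns their product into that of 1 -
  -- q^{4r}.
  refine Finset.prod_nbij' (fun r => J.card + 1 - r) (fun r => J.card + 1 - r) ?_ ?_ ?_ ?_ ?_
  all_goals intro r hr; rw [Finset.mem_Icc] at hr
  · rw [Finset.mem_Icc]; omega
  · rw [Finset.mem_Icc]; omega
  · omega
  · omega
  · rw [← zpow_natCast q 4, ← zpow_natCast, ← zpow_add₀ hq]
    congr 2
    push_cast [show r ≤ J.card by omega, show r ≤ J.card + 1 by omega]
    ring

end OrderedSum

/-! ### From the projector and metric relations to explicit relations -/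

section Relations

variable {A : Type} [Ring A] [Algebra ℂ A]

/-- The quadratic expression `∑ φ_{kl} g_k g_l`. -/
def quad (N : ℕ) (g : ℕ → A) (φ : ℕ → ℕ → ℂ) : A :=
  ∑ k ∈ Finset.Icc 1 N, ∑ l ∈ Finset.Icc 1 N, φ k l • (g k * g l)

lemma quad_add (N : ℕ) (g : ℕ → A) (φ ψ : ℕ → ℕ → ℂ) :
    quad N g (φ + ψ) = quad N g φ + quad N g ψ := by
  simp [quad, add_smul, Finset.sum_add_distrib]

lemma quad_smul (N : ℕ) (g : ℕ → A) (a : ℂ) (φ : ℕ → ℕ → ℂ) :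
    quad N g (a • φ) = a • quad N g φ := by
  simp [quad, smul_smul, Finset.smul_sum]

lemma quad_delta {N : ℕ} (g : ℕ → A) {i j : ℕ} (hi : i ∈ Finset.Icc 1 N)
    (hj : j ∈ Finset.Icc 1 N) : quad N g (fun k l => kdC k i * kdC l j) = g i * g j := by
  rw [quad, Finset.sum_eq_single_of_mem i hi, Finset.sum_eq_single_of_mem j hj]
  · simp [kdC]
  · intro l _ hl; simp [kdC, hl]
  · intro k _ hk; simp [kdC, hk]

lemma quad_metric_lt {q : ℂ} {N : ℕ} (g : ℕ → A) {j : ℕ} (hj : 2 * j ≤ N + 1) :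
    quad N g (fun k l => if k < j then Cmat q N k l else 0) =
      ∑ k ∈ Finset.Ico 1 j, q ^ (-((N : ℤ) - 2 * k)) • (g k * g (N + 1 - k)) := by
  have hsub : Finset.Ico 1 j ⊆ Finset.Icc 1 N := fun k hk => by
    rw [Finset.mem_Ico] at hk; rw [Finset.mem_Icc]; omega
  rw [quad, ← Finset.sum_subset hsub]
  · refine Finset.sum_congr rfl fun k hk => ?_
    rw [Finset.mem_Ico] at hk
    rw [Finset.sum_eq_single_of_mem (N + 1 - k) (by rw [Finset.mem_Icc]; omega)]
    · rw [if_pos hk.2, Cmat, kdC, if_pos (by unfold bar; omega), mul_one, twoRho,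
        if_pos (by unfold bar; omega)]
    · intro l hl hlk
      rw [Finset.mem_Icc] at hl
      rw [if_pos hk.2, Cmat, kdC, if_neg (by unfold bar; omega)]
      simp
  · intro k hk hk'
    rw [Finset.mem_Ico] at hk'
    rw [Finset.mem_Icc] at hk
    refine Finset.sum_eq_zero fun l _ => ?_
    rw [if_neg (by omega), zero_smul]

/-- Each column is a combination of four quadratic forms: two monomials, the metric truncated to k <
j (from the condition i < l in the braid matrix), and the full metric. -/
lemma Pplus_eq (q : ℂ) (N i j : ℕ) :
    (fun k l => Pplus q N k l i j) = (1 / (q ^ (2 : ℤ) + q ^ (-2 : ℤ))) •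
      ((q ^ (-2 : ℤ) + (q ^ (2 : ℤ) - q ^ (-2 : ℤ)) * (if i < j then 1 else 0)) •
          (fun k l => kdC k i * kdC l j) +
        q ^ (2 * kd j i - 2 * kd j (bar N i)) • (fun k l => kdC k j * kdC l i) +
        (-(q ^ (2 : ℤ) - q ^ (-2 : ℤ)) * Cmat q N i j) •
          (fun k l => if k < j then Cmat q N k l else 0) +
        (-((q + q⁻¹) * (q - q⁻¹) / (q ^ (2 * N) - 1)) * Cmat q N i j) • Cmat q N) := by
  funext k l
  have e1 : q ^ (2 * kd k l - 2 * kd k (bar N l)) * kdC k j * kdC l i =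
      q ^ (2 * kd j i - 2 * kd j (bar N i)) * (kdC k j * kdC l i) := by
    by_cases hk : k = j
    · by_cases hl : l = i
      · rw [hk, hl, mul_assoc]
      · simp [kdC, hl]
    · simp [kdC, hk]
  have e2 : (if k < j then (1 : ℂ) else 0) * (kdC k i * kdC l j) =
      (if i < j then 1 else 0) * (kdC k i * kdC l j) := by
    by_cases hk : k = i
    · rw [hk]
    · simp [kdC, hk]
  have e3 : (if k < j then (1 : ℂ) else 0) * Kmat q N k l i j =
      Cmat q N i j * (if k < j then Cmat q N k l else 0) := by
    split_ifs <;> simp [Kmat, mul_comm]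
  simp only [Pplus, Rmat, Pi.smul_apply, Pi.add_apply, smul_eq_mul]
  congr 1
  rw [e1, mul_assoc (q ^ (2 : ℤ) - q ^ (-2 : ℤ)) (if k < j then (1 : ℂ) else 0), mul_sub, e2, e3,
    Kmat]
  ring

/-- The metric relation replaces the full metric by a scalar, whose factor q^{2N} - 1 cancels the
denominator in P_+. -/
lemma quad_relation {q c2 : ℂ} {N : ℕ} {g : ℕ → A}
    (hD : q ^ (2 : ℤ) + q ^ (-2 : ℤ) ≠ 0)
    (hP : ∀ i ∈ Finset.Icc 1 N, ∀ j ∈ Finset.Icc 1 N, quad N g (fun k l => Pplus q N k l i j) = 0)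
    (hM : quad N g (Cmat q N) = (c2 * ((q ^ (2 * N) - 1) / (q ^ 2 - 1))) • 1)
    (hN : q ^ (2 * N) - 1 ≠ 0)
    {i j : ℕ} (hi : i ∈ Finset.Icc 1 N) (hj : j ∈ Finset.Icc 1 N) :
    (q ^ (-2 : ℤ) + (q ^ (2 : ℤ) - q ^ (-2 : ℤ)) * (if i < j then 1 else 0)) • (g i * g j) +
        q ^ (2 * kd j i - 2 * kd j (bar N i)) • (g j * g i) =
      Cmat q N i j • ((q ^ (2 : ℤ) - q ^ (-2 : ℤ)) •
          quad N g (fun k l => if k < j then Cmat q N k l else 0) +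
        ((q + q⁻¹) * (q - q⁻¹) * c2 / (q ^ 2 - 1)) • 1) := by
  have h := hP i hi j hj
  rw [Pplus_eq, quad_smul, quad_add, quad_add, quad_add, quad_smul, quad_smul, quad_smul, quad_smul,
    quad_delta g hi hj, quad_delta g hj hi, hM, smul_eq_zero, or_iff_right (by simpa using hD)] at h
  rw [← sub_eq_zero, ← h, smul_smul]
  have : (q + q⁻¹) * (q - q⁻¹) * c2 / (q ^ 2 - 1) = (q + q⁻¹) * (q - q⁻¹) / (q ^ (2 * N) - 1) *
      (c2 * ((q ^ (2 * N) - 1) / (q ^ 2 - 1))) := by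
    field_simp
  rw [this]
  module

theorem isQClifford_of_quad {q c2 : ℂ} {N : ℕ} {g : ℕ → A} (hq0 : q ≠ 0)
    (hq : ∀ m : ℕ, 1 ≤ m → q ^ m ≠ 1) (hN : 1 ≤ N) (hc : c2 ≠ 0)
    (hg : g 0 = 0)
    (hP : ∀ i ∈ Finset.Icc 1 N, ∀ j ∈ Finset.Icc 1 N, quad N g (fun k l => Pplus q N k l i j) = 0)
    (hM : quad N g (Cmat q N) = (c2 * ((q ^ (2 * N) - 1) / (q ^ 2 - 1))) • 1) :
    IsQClifford q c2 N g := by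
  have z2 : q ^ (2 : ℤ) = q ^ 2 := zpow_natCast q 2
  have z2' : q ^ (-2 : ℤ) = (q ^ 2)⁻¹ := by rw [zpow_neg, z2]
  have hq2 : q ^ 2 ≠ 0 := pow_ne_zero 2 hq0
  have hD : q ^ (2 : ℤ) + q ^ (-2 : ℤ) ≠ 0 := by
    rw [z2, z2']
    intro h0
    -- If q² + q⁻² = 0, then q⁴ = -1 and q⁸ = 1.
    apply hq 8 (by norm_num)
    field_simp at h0
    linear_combination (q ^ 4 - 1) * h0
  have hq21 : q ^ 2 - 1 ≠ 0 := sub_ne_zero.2 (hq 2 (by norm_num))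
  have hqq : q + q⁻¹ ≠ 0 := by
    intro h0
    apply hq 4 (by norm_num)
    field_simp at h0
    linear_combination (q ^ 2 - 1) * h0
  have hq21' : q ^ 2 + 1 ≠ 0 := by
    intro h0
    apply hq 4 (by norm_num)
    linear_combination (q ^ 2 - 1) * h0
  have rel := fun {i j : ℕ} (hi : i ∈ Finset.Icc 1 N) (hj : j ∈ Finset.Icc 1 N) =>
    quad_relation hD hP hM (sub_ne_zero.2 (hq (2 * N) (by omega))) hi hj
  refine ⟨hg, fun i j hi hij hj hne => ?_, fun i hi hiN hne => ?_, fun i hi hi2 => ?_,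
    fun i hi2 => ?_⟩
  · have := rel (i := i) (j := j) (by rw [Finset.mem_Icc]; omega) (by rw [Finset.mem_Icc]; omega)
    rw [if_pos hij, Cmat, kdC, if_neg (by unfold bar; omega), mul_zero, zero_smul, kd, kd,
      if_neg (by omega), if_neg (by unfold bar; omega)] at this
    rw [← sub_eq_zero, ← this, z2, z2']
    simp only [mul_zero, sub_zero, zpow_zero]
    module
  · have := rel (i := i) (j := i) (by rw [Finset.mem_Icc]; omega) (by rw [Finset.mem_Icc]; omega)
    rw [if_neg (by omega), Cmat, kdC, if_neg (by unfold bar; omega), mul_zero, mul_zero, zero_smul, kd, kd,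
      if_pos rfl, if_neg (by unfold bar; omega), ← add_smul, smul_eq_zero, or_iff_right] at this
    · exact this
    · intro h0
      apply hD
      rw [← h0]
      norm_num
      ring
  -- The relation is taken at (i', i), not at (i, i'): both monomials then have the coefficient q⁻²,
  -- and the truncated metric runs only over k < i.
  · have := rel (i := N + 1 - i) (j := i) (by rw [Finset.mem_Icc]; omega)
      (by rw [Finset.mem_Icc]; omega)
    rw [if_neg (by omega), Cmat, kdC, if_pos (by unfold bar; omega), twoRho,
      if_neg (by unfold bar; omega), if_pos (by unfold bar; omega), kd, kd, if_neg (by omega),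
      if_pos (by unfold bar; omega), show bar N (N + 1 - i) = i by unfold bar; omega,
      quad_metric_lt g (by omega), neg_neg] at this
    have e : q ^ (-2 : ℤ) • (g i * g (N + 1 - i) + g (N + 1 - i) * g i) =
        q ^ ((N : ℤ) - 2 * i) • ((q ^ (2 : ℤ) - q ^ (-2 : ℤ)) •
          ∑ k ∈ Finset.Ico 1 i, q ^ (-((N : ℤ) - 2 * k)) • (g k * g (N + 1 - k)) +
          ((q + q⁻¹) * (q - q⁻¹) * c2 / (q ^ 2 - 1)) • 1) := by
      rw [mul_one (q ^ ((N : ℤ) - 2 * i))] at this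
      rw [← this]
      norm_num
      abel
    have e' : g i * g (N + 1 - i) + g (N + 1 - i) * g i =
        q ^ (2 : ℤ) • (q ^ (-2 : ℤ) • (g i * g (N + 1 - i) + g (N + 1 - i) * g i)) := by
      rw [smul_smul, ← zpow_add₀ hq0]
      simp
    rw [e', e, deform]
    simp only [smul_add, smul_smul, Finset.smul_sum]
    rw [add_comm]
    congr 1
    · congr 1
      rw [scale, show (N : ℤ) + 1 - 2 * i = ((N : ℤ) - 2 * i) + 1 by ring, zpow_add₀ hq0, zpow_one, z2]
      field_simp
    · refine Finset.sum_congr rfl fun k _ => ?_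
      congr 1
      rw [scale, scale, mul_inv, ← zpow_neg,
        show (N : ℤ) + 1 - 2 * i = ((N : ℤ) - 2 * i) + 1 by ring,
        show -((N : ℤ) + 1 - 2 * k) = -((N : ℤ) - 2 * k) + (-1) by ring, zpow_add₀ hq0,
        zpow_add₀ hq0, z2, z2', zpow_one, zpow_neg_one]
      field_simp
  · have := rel (i := i) (j := i) (by rw [Finset.mem_Icc]; omega) (by rw [Finset.mem_Icc]; omega)
    rw [if_neg (by omega), Cmat, kdC, if_pos (by unfold bar; omega), twoRho,
      if_neg (by unfold bar; omega), if_neg (by unfold bar; omega), kd, kd, if_pos rfl,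
      if_pos (by unfold bar; omega), quad_metric_lt g (by omega), ← add_smul] at this
    have hne : q * (q + q⁻¹)⁻¹ * (q ^ (-2 : ℤ) + 1) = 1 := by
      rw [z2']
      field_simp
      ring
    have e' : g i * g i = (q * (q + q⁻¹)⁻¹) • ((q ^ (-2 : ℤ) + 1) • (g i * g i)) := by
      rw [smul_smul, hne, one_smul]
    have e : (q ^ (-2 : ℤ) + 1) • (g i * g i) = (q ^ (2 : ℤ) - q ^ (-2 : ℤ)) •
          ∑ k ∈ Finset.Ico 1 i, q ^ (-((N : ℤ) - 2 * k)) • (g k * g (N + 1 - k)) +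
          ((q + q⁻¹) * (q - q⁻¹) * c2 / (q ^ 2 - 1)) • 1 := by
      rw [neg_zero, zpow_zero, mul_one (1 : ℂ), one_smul] at this
      rw [← this]
      norm_num
    rw [e', e, deform]
    simp only [smul_add, smul_smul, Finset.smul_sum]
    rw [add_comm]
    congr 1
    · congr 1
      field_simp
    · refine Finset.sum_congr rfl fun k _ => ?_
      congr 1
      rw [scale, mul_inv, ← zpow_neg,
        show -((N : ℤ) + 1 - 2 * k) = -((N : ℤ) - 2 * k) + (-1) by ring, zpow_add₀ hq0, z2, z2',
        zpow_neg_one]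
      field_simp

lemma γ_zero (q c2 : ℂ) (N : ℕ) : γ q c2 N 0 = 0 := by simp [γ, clLetter]

theorem isQClifford_γ {q c2 : ℂ} {N : ℕ} (hq0 : q ≠ 0)
    (hq : ∀ m : ℕ, 1 ≤ m → q ^ m ≠ 1) (hN : 1 ≤ N) (hc : c2 ≠ 0)
    : IsQClifford q c2 N (γ q c2 N) := by
  refine isQClifford_of_quad hq0 hq hN hc (γ_zero q c2 N) (fun i hi j hj => ?_) ?_
  · have := RingQuot.mkAlgHom_rel ℂ (ClRel.proj (q := q) (c2 := c2) i j hi hj)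
    simpa [map_sum, quad, γ] using this
  · have := RingQuot.mkAlgHom_rel ℂ (ClRel.metric (q := q) (c2 := c2) (N := N))
    rw [AlgHom.commutes, Algebra.algebraMap_eq_smul_one] at this
    rw [← this]
    simp [map_sum, quad, γ]

end Relations

/-! ### Images of the generators in terms of γ -/

section Images

variable {A : Type} [Ring A] [Algebra ℂ A]

/-- Here x_{-m} x_m is the complementary idempotent 1 - x_m x_{-m}. -/
lemma IsCAR.grp_neg {n : ℕ} {x : ℤ → A} (h : IsCAR n x) {p : ℂ} (hp : p ≠ 0) {m : ℤ}
    (hm : m.natAbs ≤ n) (hm0 : m ≠ 0) : grp x p (-m) = p ^ 2 • grp x p⁻¹ m := by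
  have h1 : x (-m) * x m = 1 - x m * x (-m) := by rw [← h.pair m hm hm0]; abel
  rw [grp_eq x p (neg_ne_zero.2 hm0), neg_neg, h1, grp_eq x _ hm0]
  match_scalars <;> field_simp <;> ring

namespace IsQClifford

variable {q c : ℂ} {N : ℕ} {g : ℕ → A} (h : IsQClifford q c N g) (hq : q ≠ 0)
  (hs : ∀ k, scale q c N k ≠ 0)

lemma mode_pos (q c : ℂ) (N : ℕ) (g : ℕ → A) {k : ℕ} (hk : 1 ≤ k) (hk2 : 2 * k ≤ N) :
    mode q c N g k = tau q c N g k * g k := by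
  rw [mode, psi, show modeIndex N k = k by unfold modeIndex; split_ifs <;> omega,
    show modeScale q c N k = 1 by unfold modeScale; split_ifs <;> first | rfl | omega, one_smul,
    show min k (N + 1 - k) = k by omega]

lemma mode_neg (q c : ℂ) (N : ℕ) (g : ℕ → A) {k : ℕ} (hk : 1 ≤ k) (hk2 : 2 * k ≤ N) :
    mode q c N g (-k) = (scale q c N k)⁻¹ • (tau q c N g k * g (N + 1 - k)) := by
  rw [mode, psi, show modeIndex N (-k) = N + 1 - k by unfold modeIndex; split_ifs <;> omega,
    show modeScale q c N (-k) = (scale q c N k)⁻¹ by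
      unfold modeScale; split_ifs <;> first | omega | simp,
    show min (N + 1 - k) (N + 1 - (N + 1 - k)) = k by omega]

lemma mode_zero (q c : ℂ) {N : ℕ} (g : ℕ → A) (hN : N % 2 = 1) :
    mode q c N g 0 = tau q c N g (N / 2 + 1) * g (N / 2 + 1) := by
  rw [mode, psi, show modeIndex N 0 = N / 2 + 1 by unfold modeIndex; split_ifs <;> omega,
    show modeScale q c N 0 = 1 by simp [modeScale], one_smul,
    show min (N / 2 + 1) (N + 1 - (N / 2 + 1)) = N / 2 + 1 by omega]

include h hq hs

lemma grp_mode {k : ℕ} (hk : 1 ≤ k) (hk2 : 2 * k ≤ N) (p : ℂ) :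
    grp (mode q c N g) p k = 1 + (p ^ 2 - 1) • occ q c N g k := by
  rw [grp_eq _ _ (by omega), h.mode_mul_neg hq hs hk hk2]

/-- The negative mode -(i+1) yields a factor p² that cancels the normalisation of `grp₂`. This is
why K_i carries no scalar prefactor for i < n, in contrast to K_n. -/
lemma grp₂_chain {i : ℕ} (hi : 1 ≤ i) (hi2 : 2 * (i + 1) ≤ N) {p : ℂ} (hp : p ≠ 0) :
    grp₂ (mode q c N g) p i (-(i + 1)) =
      (1 + (p ^ 2 - 1) • occ q c N g i) * (1 + ((p ^ 2)⁻¹ - 1) • occ q c N g (i + 1)) := by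
  have h1 := h.grp_mode hq hs (k := i + 1) (by omega) hi2 p⁻¹
  push_cast at h1
  rw [grp₂, (h.isCAR_mode hq hs).grp_neg hp (by omega) (by omega), h1,
    h.grp_mode hq hs hi (by omega), mul_smul_comm, smul_smul, inv_mul_cancel₀ (pow_ne_zero 2 hp),
    one_smul, inv_pow]

lemma grp₂_short {i : ℕ} (hi : 1 ≤ i) (hi2 : 2 * i ≤ N) {p : ℂ} (hp : p ≠ 0) :
    grp₂ (mode q c N g) p i 0 = p⁻¹ • (1 + (p ^ 2 - 1) • occ q c N g i) := by
  rw [grp₂, h.grp_mode hq hs hi hi2, grp, if_pos rfl, mul_smul_comm, mul_one, smul_smul]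
  congr 1
  field_simp

lemma grp₂_fork {i : ℕ} (hi : 1 ≤ i) (hi2 : 2 * (i + 1) ≤ N) {p : ℂ} :
    grp₂ (mode q c N g) p i ((i + 1 : ℕ) : ℤ) =
      (p ^ 2)⁻¹ • ((1 + (p ^ 2 - 1) • occ q c N g i) * (1 + (p ^ 2 - 1) • occ q c N g (i + 1))) := by
  rw [grp₂, h.grp_mode hq hs hi (by omega), h.grp_mode hq hs (by omega) hi2]

lemma osum_cartan (μ : ℕ → ℂ) {m : ℕ} (hm : 2 * m ≤ N) :
    osum q c N g m (fun l r j => μ j - q ^ (4 * (l : ℤ) - 4 * r)) 1 = prodGrp q c N g μ m := by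
  have := h.osum_eq hq hs μ hm one_ne_zero (mid := 1) (by simp)
  simpa using this

lemma osum_cartan_two {μ : ℕ → ℂ} {m : ℕ} (hm : 2 * (m + 2) ≤ N)
    (hμ : ∀ j, 1 ≤ j → j ≤ m → μ j = 1) :
    osum q c N g (m + 2) (fun l r j => μ j - q ^ (4 * (l : ℤ) - 4 * r)) 1 =
      (1 + (μ (m + 1) - 1) • occ q c N g (m + 1)) * (1 + (μ (m + 2) - 1) • occ q c N g (m + 2)) := by
  rw [h.osum_cartan hq hs μ hm, prodGrp, prodGrp, prodGrp_eq_one hμ, one_mul]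

lemma osum_cartan_one {μ : ℕ → ℂ} {m : ℕ} (hm : 2 * (m + 1) ≤ N)
    (hμ : ∀ j, 1 ≤ j → j ≤ m → μ j = 1) :
    osum q c N g (m + 1) (fun l r j => μ j - q ^ (4 * (l : ℤ) - 4 * r)) 1 =
      1 + (μ (m + 1) - 1) • occ q c N g (m + 1) := by
  rw [h.osum_cartan hq hs μ hm, prodGrp, prodGrp_eq_one hμ, one_mul]

lemma lower_chain {i : ℕ} (hi : 1 ≤ i) (hi2 : 2 * (i + 1) ≤ N) :
    mode q c N g i * mode q c N g (-(i + 1)) =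
      (scale q c N (i + 1))⁻¹ • (tau q c N g i * tau q c N g i * (g i * g (N - i))) := by
  have h1 := mode_neg q c N g (k := i + 1) (by omega) hi2
  push_cast at h1
  rw [h1, mode_pos q c N g hi (by omega), mul_smul_comm, h.lower_mul_tau_succ hq hs hi (by omega)]

lemma raise_chain {i : ℕ} (hi : 1 ≤ i) (hi2 : 2 * (i + 1) ≤ N) :
    mode q c N g (i + 1) * mode q c N g (-i) =
      (scale q c N i)⁻¹ • (tau q c N g i * tau q c N g i * (g (i + 1) * g (N + 1 - i))) := by
  have h1 := mode_pos q c N g (k := i + 1) (by omega) hi2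
  push_cast at h1
  rw [h1, mode_neg q c N g hi (by omega), mul_smul_comm,
    h.tau_succ_mul_upper hq hs hi (by omega) (by omega) (by omega)]

lemma lower_short (hN : N % 2 = 1) (hN3 : 3 ≤ N) :
    mode q c N g ((N / 2 : ℕ) : ℤ) * mode q c N g 0 =
      tau q c N g (N / 2) * tau q c N g (N / 2) * (g (N / 2) * g (N / 2 + 1)) := by
  rw [mode_zero q c g hN, mode_pos q c N g (by omega) (by omega),
    h.lower_mul_tau_succ hq hs (by omega) (by omega)]

lemma raise_short (hN : N % 2 = 1) (hN3 : 3 ≤ N) :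
    mode q c N g 0 * mode q c N g (-((N / 2 : ℕ) : ℤ)) = (scale q c N (N / 2))⁻¹ •
      (tau q c N g (N / 2) * tau q c N g (N / 2) * (g (N / 2 + 1) * g (N / 2 + 2))) := by
  rw [mode_zero q c g hN, mode_neg q c N g (by omega) (by omega), mul_smul_comm,
    h.tau_succ_mul_upper hq hs (by omega) (by omega) (by omega) (by omega),
    show N + 1 - N / 2 = N / 2 + 2 by omega]

lemma lower_fork {i : ℕ} (hi : 1 ≤ i) (hi2 : 2 * (i + 1) = N) :
    mode q c N g i * mode q c N g ((i + 1 : ℕ) : ℤ) =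
      tau q c N g i * tau q c N g i * (g i * g (i + 1)) := by
  rw [mode_pos q c N g hi (by omega), mode_pos q c N g (by omega) (by omega),
    h.lower_mul_tau_succ hq hs hi (by omega)]

lemma raise_fork {i : ℕ} (hi : 1 ≤ i) (hi2 : 2 * (i + 1) = N) :
    mode q c N g (-((i + 1 : ℕ) : ℤ)) * mode q c N g (-i) =
      ((scale q c N (i + 1))⁻¹ * (scale q c N i)⁻¹) •
        (tau q c N g i * tau q c N g i * (g (i + 2) * g (i + 3))) := by
  rw [mode_neg q c N g hi (by omega), mode_neg q c N g (by omega) (by omega), smul_mul_smul_comm,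
    h.tau_succ_mul_upper hq hs hi (by omega) (by omega) (by omega),
    show N + 1 - (i + 1) = i + 2 by omega, show N + 1 - i = i + 3 by omega]

end IsQClifford

end Images

/-! ### Values of λ on the lower indices, and the sums for the generators γ -/

lemma lam_chain (q : ℂ) {N i j : ℕ} (hi : i < N / 2) (hj : j ≤ N / 2) :
    lam q N i j = if j = i then (q ^ 2)⁻¹ else if j = i + 1 then q ^ 2 else 1 := by
  have z2 : q ^ (2 : ℤ) = q ^ 2 := zpow_natCast q 2
  rw [lam, if_pos hi, ← z2, ← zpow_neg]
  unfold kd bar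
  rw [if_neg (show ¬ j = N + 1 - i - 1 by omega), if_neg (show ¬ j = N + 1 - i by omega)]
  split_ifs <;> first | omega | simp

lemma lam_short (q : ℂ) {N j : ℕ} (hN : N % 2 = 1) (hj : j ≤ N / 2) :
    lam q N (N / 2) j = if j = N / 2 then (q ^ 2)⁻¹ else 1 := by
  have z2 : q ^ (2 : ℤ) = q ^ 2 := zpow_natCast q 2
  rw [lam, if_neg (lt_irrefl _), if_pos hN, ← z2, ← zpow_neg]
  unfold kd
  split_ifs <;> first | omega | simp

lemma lam_fork (q : ℂ) {N j : ℕ} (hN : N % 2 = 0) (hN2 : 2 ≤ N) (hj : j ≤ N / 2) :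
    lam q N (N / 2) j = if j = N / 2 ∨ j + 1 = N / 2 then (q ^ 2)⁻¹ else 1 := by
  have z2 : q ^ (2 : ℤ) = q ^ 2 := zpow_natCast q 2
  rw [lam, if_neg (lt_irrefl _), if_neg (by omega), ← z2, ← zpow_neg]
  unfold kd
  split_ifs <;> first | omega | simp

lemma sumK_eq_osum (q c2 : ℂ) (N m i : ℕ) : sumK q c2 N m i =
    osum q c2 N (γ q c2 N) m (fun l r j => lam q N i j - q ^ (4 * (l : ℤ) - 4 * r)) 1 :=
  orderedSum_eq_osum ..

lemma sumKinv_eq_osum (q c2 : ℂ) (N m i : ℕ) : sumKinv q c2 N m i =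
    osum q c2 N (γ q c2 N) m (fun l r j => (lam q N i j)⁻¹ - q ^ (4 * (l : ℤ) - 4 * r)) 1 :=
  orderedSum_eq_osum ..

lemma sumEF_eq {q c2 : ℂ} {N : ℕ} (h : IsQClifford q c2 N (γ q c2 N)) (hq : q ≠ 0)
    (hs : ∀ k, scale q c2 N k ≠ 0) {m a b : ℕ} (hm : 2 * m ≤ N) (ha : m < a) (ha2 : a + m ≤ N)
    (hb : m < b) (hb2 : b + m ≤ N) :
    sumEF q c2 N m a b = tau q c2 N (γ q c2 N) (m + 1) * tau q c2 N (γ q c2 N) (m + 1) *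
      (γ q c2 N a * γ q c2 N b) := by
  rw [sumEF, orderedSum_eq_osum, h.osum_root hq hs hm ha ha2 hb hb2]

end QuantumClifford

end

/-! ### The theorem -/

open QuantumClifford in
theorem theorem2 (q : ℂ) (hq0 : q ≠ 0) (hq : ∀ m : ℕ, 1 ≤ m → q ^ m ≠ 1)
    (N n ε : ℕ) (hN : 3 ≤ N) (hε : ε = 0 ∨ ε = 1) (hn : N = 2 * n + ε)
    (c2 : ℝ) (hc2 : c2 ≠ 0)
    (q' : ℂ) (hq' : q' ^ 2 = q + q⁻¹) :
    ∃ π : QuantumClifford.Uqso q N →ₐ[ℂ] QuantumClifford.Cl q c2 N,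
      (∀ i : ℕ, 1 ≤ i → i ≤ n - 1 →
        π (QuantumClifford.genK q N i) = QuantumClifford.sumK q c2 N (i + 1) i ∧
        π (QuantumClifford.genKinv q N i) = QuantumClifford.sumKinv q c2 N (i + 1) i ∧
        π (QuantumClifford.genE q N i * QuantumClifford.genKinv q N i) =
          (q ^ (2 * (i : ℤ) + 1 - N) / (c2 * (q + q⁻¹))) •
            QuantumClifford.sumEF q c2 N (i - 1) (i + 1) (QuantumClifford.bar N i) ∧
        π (QuantumClifford.genF q N i) =
          (q ^ (2 * (i : ℤ) + 1 - N) / (c2 * (q + q⁻¹))) •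
            QuantumClifford.sumEF q c2 N (i - 1) i (QuantumClifford.bar N i - 1)) ∧
      π (QuantumClifford.genK q N n) =
        q ^ (2 - (ε : ℤ)) • QuantumClifford.sumK q c2 N n n ∧
      π (QuantumClifford.genKinv q N n) =
        q ^ (-2 + (ε : ℤ)) • QuantumClifford.sumKinv q c2 N n n ∧
      (ε = 1 →
        π (QuantumClifford.genE q N n * QuantumClifford.genKinv q N n) =
          (q' / (c2 * (q + q⁻¹))) •
            QuantumClifford.sumEF q c2 N (n - 1) (n + 1) (n + 2) ∧
        π (QuantumClifford.genF q N n) =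
          (q⁻¹ * q' / (c2 * (q + q⁻¹))) •
            QuantumClifford.sumEF q c2 N (n - 1) n (n + 1)) ∧
      (ε = 0 →
        π (QuantumClifford.genE q N n * QuantumClifford.genKinv q N n) =
          (q⁻¹ / (c2 * (q + q⁻¹))) •
            QuantumClifford.sumEF q c2 N (n - 2) (n + 1) (n + 2) ∧
        π (QuantumClifford.genF q N n) =
          (q⁻¹ / (c2 * (q + q⁻¹))) •
            QuantumClifford.sumEF q c2 N (n - 2) (n - 1) n) := by
  have hqq : q + q⁻¹ ≠ 0 := by
    intro h0
    apply hq 4 (by norm_num)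
    field_simp at h0
    linear_combination (q ^ 2 - 1) * h0
  have hq21 : q ^ 2 + 1 ≠ 0 := by
    intro h0
    apply hq 4 (by norm_num)
    linear_combination (q ^ 2 - 1) * h0
  have hc : (c2 : ℂ) ≠ 0 := by exact_mod_cast hc2
  have hs : ∀ k, scale q c2 N k ≠ 0 := fun k =>
    mul_ne_zero (mul_ne_zero hc hqq) (zpow_ne_zero _ hq0)
  have hγ : IsQClifford q c2 N (γ q c2 N) := isQClifford_γ hq0 hq (by omega) hc
  have hcar := hγ.isCAR_mode hq0 hs
  obtain rfl : n = N / 2 := by omega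
  obtain rfl : ε = N % 2 := by omega
  have z2 : q ^ (2 : ℤ) = q ^ 2 := zpow_natCast q 2
  obtain ⟨π, hπ⟩ := hcar.exists_algHom (c := c2)
    -- The values of u are the coefficients prescribed for F_n; those of t are then forced by the
    -- commutator of E_n and F_n. For odd N the condition is q'² = q + q⁻¹.
    (t := fun i => if i < N / 2 then 1 else if N % 2 = 1 then q' * q else c2 * (q + q⁻¹) * q)
    (u := fun i => if i < N / 2 then 1 else if N % 2 = 1 then q⁻¹ * q' / (c2 * (q + q⁻¹))
      else q⁻¹ / (c2 * (q + q⁻¹))) hq0 hq hN (hγ.mode_zero_sq hq0 hs) (fun i hi => by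
      have hm := mode_cases hN hi
      rw [Finset.mem_Icc] at hi
      rcases hm with ⟨h1, -, h2⟩ | ⟨h1, h3, -, h2⟩ | ⟨h1, h3, h4, -, h2⟩
      · simp only [if_pos h1, if_neg (show modeB N i ≠ 0 by omega), mul_one]
      · simp only [if_neg (show ¬ i < N / 2 by omega), if_pos h3, if_pos h2]
        calc q' * q * (q⁻¹ * q' / (c2 * (q + q⁻¹))) * c2
            = q' ^ 2 * ((q * q⁻¹) * (c2 / (c2 * (q + q⁻¹)))) := by ring
          _ = 1 := by rw [hq', mul_inv_cancel₀ hq0]; field_simp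
      · simp only [if_neg (show ¬ i < N / 2 by omega), if_neg (show ¬ N % 2 = 1 by omega),
          if_neg (show modeB N i ≠ 0 by omega)]
        field_simp)
  refine ⟨π, fun i hi hi2 => ?_, ?_, ?_, fun hε => ?_, fun hε => ?_⟩
  · have hmem : i ∈ Finset.Icc 1 (N / 2) := by rw [Finset.mem_Icc]; omega
    obtain ⟨hE, hF, hK, hKi⟩ := hπ i hmem
    have hlt : i < N / 2 := by omega
    obtain ⟨ha, hb⟩ : modeA N i = i ∧ modeB N i = -(i + 1) := by
      have := mode_cases hN hmem; omega
    -- The factor q² comes from multiplying E_i by K_i⁻¹; it compensates for the normalisation s_i,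
    -- where F_i involves s_{i+1}.
    have hcoef : q ^ 2 * (scale q c2 N i)⁻¹ = q ^ (2 * (i : ℤ) + 1 - N) / (c2 * (q + q⁻¹)) := by
      rw [scale, show 2 * (i : ℤ) + 1 - N = 2 + -((N : ℤ) + 1 - 2 * i) by ring, zpow_add₀ hq0, z2,
        zpow_neg]
      field_simp
    have hcoef' : (scale q c2 N (i + 1))⁻¹ = q ^ (2 * (i : ℤ) + 1 - N) / (c2 * (q + q⁻¹)) := by
      rw [scale, show 2 * (i : ℤ) + 1 - N = -((N : ℤ) + 1 - 2 * ((i + 1 : ℕ) : ℤ)) by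
        push_cast; ring, zpow_neg]
      field_simp
    obtain ⟨k, rfl⟩ : ∃ k, i = k + 1 := ⟨i - 1, by omega⟩
    have l1 : lam q N (k + 1) (k + 1) = (q ^ 2)⁻¹ := by
      rw [lam_chain q hlt (by omega), if_pos rfl]
    have l2 : lam q N (k + 1) (k + 2) = q ^ 2 := by
      rw [lam_chain q hlt (by omega), if_neg (by omega), if_pos rfl]
    have l3 : ∀ j, 1 ≤ j → j ≤ k → lam q N (k + 1) j = 1 := fun j _ hj => by
      rw [lam_chain q hlt (by omega), if_neg (by omega), if_neg (by omega)]
    refine ⟨?_, ?_, ?_, ?_⟩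
    · rw [hK, ha, hb, hγ.grp₂_chain hq0 hs hi (by omega) (inv_ne_zero hq0), sumK_eq_osum,
        hγ.osum_cartan_two hq0 hs (by omega) l3, l1, l2, inv_pow, inv_inv]
    · rw [hKi, ha, hb, hγ.grp₂_chain hq0 hs hi (by omega) hq0, sumKinv_eq_osum,
        hγ.osum_cartan_two hq0 hs (by omega) (fun j h1 h2 => by rw [l3 j h1 h2, inv_one]), l1, l2,
        inv_inv]
    · rw [map_mul, hE, hKi, if_pos hlt, one_smul,
        hcar.mul_grp₂ (by omega) (by omega) (by omega) (by omega) (by omega) (by omega) hq0, ha, hb,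
        neg_neg, hγ.raise_chain hq0 hs hi (by omega), smul_smul, hcoef,
        sumEF_eq hγ hq0 hs (by omega) (by omega) (by omega) (by unfold bar; omega)
          (by unfold bar; omega)]
      rfl
    · rw [hF, if_pos hlt, one_smul, ha, hb, hγ.lower_chain hq0 hs hi (by omega), hcoef',
        sumEF_eq hγ hq0 hs (by omega) (by omega) (by omega) (by unfold bar; omega)
          (by unfold bar; omega)]
      rw [show bar N (k + 1) - 1 = N - (k + 1) by unfold bar; omega]
      rfl
  · have hmem : N / 2 ∈ Finset.Icc 1 (N / 2) := by rw [Finset.mem_Icc]; omega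
    obtain ⟨-, -, hK, -⟩ := hπ _ hmem
    have hm := mode_cases hN hmem
    rw [hK, sumK_eq_osum]
    rcases hε with hε | hε
    · obtain ⟨k, hk⟩ : ∃ k, N / 2 = k + 2 := ⟨N / 2 - 2, by omega⟩
      obtain ⟨ha, hb⟩ : modeA N (N / 2) = (k + 1 : ℕ) ∧ modeB N (N / 2) = (k + 1 + 1 : ℕ) := by
        omega
      have l1 : lam q N (N / 2) (k + 1) = (q ^ 2)⁻¹ := by
        rw [lam_fork q hε (by omega) (by omega), if_pos (by omega)]
      have l2 : lam q N (N / 2) (k + 2) = (q ^ 2)⁻¹ := by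
        rw [lam_fork q hε (by omega) (by omega), if_pos (by omega)]
      have l3 : ∀ j, 1 ≤ j → j ≤ k → lam q N (N / 2) j = 1 := fun j _ hj => by
        rw [lam_fork q hε (by omega) (by omega), if_neg (by omega)]
      rw [ha, hb, hγ.grp₂_fork hq0 hs (by omega) (by omega), hε]
      rw [show osum q c2 N (γ q c2 N) (N / 2) = osum q c2 N (γ q c2 N) (k + 2) by rw [hk],
        hγ.osum_cartan_two hq0 hs (by omega) l3, l1, l2]
      simp [z2]
    · obtain ⟨k, hk⟩ : ∃ k, N / 2 = k + 1 := ⟨N / 2 - 1, by omega⟩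
      obtain ⟨ha, hb⟩ : modeA N (N / 2) = (k + 1 : ℕ) ∧ modeB N (N / 2) = 0 := by omega
      have l1 : lam q N (N / 2) (k + 1) = (q ^ 2)⁻¹ := by
        rw [lam_short q hε (by omega), if_pos (by omega)]
      have l3 : ∀ j, 1 ≤ j → j ≤ k → lam q N (N / 2) j = 1 := fun j _ hj => by
        rw [lam_short q hε (by omega), if_neg (by omega)]
      rw [ha, hb, hγ.grp₂_short hq0 hs (by omega) (by omega) (inv_ne_zero hq0), hε]
      rw [show osum q c2 N (γ q c2 N) (N / 2) = osum q c2 N (γ q c2 N) (k + 1) by rw [hk],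
        hγ.osum_cartan_one hq0 hs (by omega) l3, l1]
      norm_num
  · have hmem : N / 2 ∈ Finset.Icc 1 (N / 2) := by rw [Finset.mem_Icc]; omega
    obtain ⟨-, -, -, hK⟩ := hπ _ hmem
    have hm := mode_cases hN hmem
    rw [hK, sumKinv_eq_osum]
    rcases hε with hε | hε
    · obtain ⟨k, hk⟩ : ∃ k, N / 2 = k + 2 := ⟨N / 2 - 2, by omega⟩
      obtain ⟨ha, hb⟩ : modeA N (N / 2) = (k + 1 : ℕ) ∧ modeB N (N / 2) = (k + 1 + 1 : ℕ) := by
        omega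
      have l1 : lam q N (N / 2) (k + 1) = (q ^ 2)⁻¹ := by
        rw [lam_fork q hε (by omega) (by omega), if_pos (by omega)]
      have l2 : lam q N (N / 2) (k + 2) = (q ^ 2)⁻¹ := by
        rw [lam_fork q hε (by omega) (by omega), if_pos (by omega)]
      have l3 : ∀ j, 1 ≤ j → j ≤ k → lam q N (N / 2) j = 1 := fun j _ hj => by
        rw [lam_fork q hε (by omega) (by omega), if_neg (by omega)]
      rw [ha, hb, hγ.grp₂_fork hq0 hs (by omega) (by omega), hε]
      rw [show osum q c2 N (γ q c2 N) (N / 2) = osum q c2 N (γ q c2 N) (k + 2) by rw [hk],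
        hγ.osum_cartan_two hq0 hs (by omega) (fun j h1 h2 => by rw [l3 j h1 h2, inv_one]), l1, l2]
      simp [zpow_neg, z2]
    · obtain ⟨k, hk⟩ : ∃ k, N / 2 = k + 1 := ⟨N / 2 - 1, by omega⟩
      obtain ⟨ha, hb⟩ : modeA N (N / 2) = (k + 1 : ℕ) ∧ modeB N (N / 2) = 0 := by omega
      have l1 : lam q N (N / 2) (k + 1) = (q ^ 2)⁻¹ := by
        rw [lam_short q hε (by omega), if_pos (by omega)]
      have l3 : ∀ j, 1 ≤ j → j ≤ k → lam q N (N / 2) j = 1 := fun j _ hj => by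
        rw [lam_short q hε (by omega), if_neg (by omega)]
      rw [ha, hb, hγ.grp₂_short hq0 hs (by omega) (by omega) hq0, hε]
      rw [show osum q c2 N (γ q c2 N) (N / 2) = osum q c2 N (γ q c2 N) (k + 1) by rw [hk],
        hγ.osum_cartan_one hq0 hs (by omega) (fun j h1 h2 => by rw [l3 j h1 h2, inv_one]), l1]
      norm_num
  · have hmem : N / 2 ∈ Finset.Icc 1 (N / 2) := by rw [Finset.mem_Icc]; omega
    obtain ⟨hE, hF, -, hKi⟩ := hπ _ hmem
    obtain ⟨ha, hb⟩ : modeA N (N / 2) = (N / 2 : ℕ) ∧ modeB N (N / 2) = 0 := by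
      have := mode_cases hN hmem; omega
    have e : tau q c2 N (γ q c2 N) (N / 2 - 1 + 1) = tau q c2 N (γ q c2 N) (N / 2) := by
      rw [show N / 2 - 1 + 1 = N / 2 by omega]
    constructor
    · rw [map_mul, hE, hKi, if_neg (by omega), if_pos hε, ha, hb, neg_zero, smul_mul_assoc,
        hcar.mul_grp₂_zero (by omega) (by omega) hq0, hγ.raise_short hq0 hs hε hN, smul_smul,
        smul_smul, sumEF_eq hγ hq0 hs (by omega) (by omega) (by omega) (by omega) (by omega), e,
        scale, show (N : ℤ) + 1 - 2 * ((N / 2 : ℕ) : ℤ) = 2 by omega, z2]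
      -- The factors are q'q from t, q from K_n⁻¹ and q⁻² from 1 / s_n, leaving q'.
      congr 1
      field_simp
    · rw [hF, if_neg (by omega), if_pos hε, ha, hb, hγ.lower_short hq0 hs hε hN,
        sumEF_eq hγ hq0 hs (by omega) (by omega) (by omega) (by omega) (by omega), e]
  · have hmem : N / 2 ∈ Finset.Icc 1 (N / 2) := by rw [Finset.mem_Icc]; omega
    obtain ⟨hE, hF, -, hKi⟩ := hπ _ hmem
    obtain ⟨k, hk⟩ : ∃ k, N / 2 = k + 2 := ⟨N / 2 - 2, by omega⟩
    obtain ⟨ha, hb⟩ : modeA N (N / 2) = (k + 1 : ℕ) ∧ modeB N (N / 2) = (k + 1 + 1 : ℕ) := by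
      have := mode_cases hN hmem; omega
    constructor
    · rw [map_mul, hE, hKi, if_neg (by omega), if_neg (by omega), smul_mul_assoc,
        hcar.mul_grp₂ (by omega) (by omega) (by omega) (by omega) (by omega) (by omega) hq0, ha, hb,
        hγ.raise_fork hq0 hs (by omega) (by omega), smul_smul,
        smul_smul, sumEF_eq hγ hq0 hs (by omega) (by omega) (by omega) (by omega) (by omega),
        scale, scale, show (N : ℤ) + 1 - 2 * ((k + 1 : ℕ) : ℤ) = 3 by omega,
        show (N : ℤ) + 1 - 2 * ((k + 1 + 1 : ℕ) : ℤ) = 1 by omega, hk, zpow_one,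
        show q ^ (3 : ℤ) = q ^ 3 from zpow_natCast q 3]
      -- The factors are c²[2]q from t, q² from K_n⁻¹ and q⁻¹q⁻³/(c²[2])² from the two
      -- normalisations, leaving q⁻¹/(c²[2]).
      congr 1
      field_simp
    · rw [hF, if_neg (by omega), if_neg (by omega), ha, hb,
        hγ.lower_fork hq0 hs (by omega) (by omega),
        sumEF_eq hγ hq0 hs (by omega) (by omega) (by omega) (by omega) (by omega), hk]
      rfl
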